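/- Let $k\ge 2$, $d\ge 0$ and $m\ge d+1$ be integers, and let $\mathbb Z_k$ be the cyclic group of order $k$, regarded as a discrete set of $k$ points. Let $(\mathbb Z_k)^{*n}$ be its $n$-fold join: the simplicial complex with vertex set $\{1,\dots,n\}\times\mathbb Z_k$ whose simplices are the nonempty sets of vertices with pairwise distinct first coordinates; $\mathbb Z_k$ acts on it by $g\cdot(j,s)=(j,gs)$. Let $(\mathbb Z_k)^{*m}_{\mathrm{alt}\le d}$ be the $\mathbb Z_k$-invariant subcomplex of $(\mathbb Z_k)^{*m}$ whose simplices are the nonempty subsets of the sets $\{(1,i_1),\dots,(m,i_m)\}$ with $i_1,\dots,i_m\in\mathbb Z_k$ and $\#\{j : 1\le j\le m-1,\ i_j\ne i_{j+1}\}\le d$. Let $X$ be any $\mathbb Z_k$-equivariant subdivision of $(\mathbb Z_k)^{*(d+2)}$, that is, a geometric simplicial complex subdividing the geometric realization of $(\mathbb Z_k)^{*(d+2)}$ (each simplex of $X$ lies in a simplex of $(\mathbb Z_k)^{*(d+2)}$, and each simplex of $(\mathbb Z_k)^{*(d+2)}$ is a union of finitely many simplices of $X$) whose set of simplices is invariant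 under the induced action of $\mathbb Z_k$. Then there is no $\mathbb Z_k$-equivariant simplicial map $$\ell\colon X\longrightarrow(\mathbb Z_k)^{*m}_{\mathrm{alt}\le d}.$$ -/

import Mathlib

namespace ZkTucker

/-- A set of points `V`, seen as a discrete (zero-dimensional) simplicial complex:
its simplices are the one-element sets. -/
def discreteComplex (V : Type*) : PreAbstractSimplicialComplex V where
  faces := {s | ∃ v, s = {v}}
  isRelLowerSet_faces := by
    rintro s ⟨v, rfl⟩
    refine ⟨Finset.singleton_nonempty v, fun t hts ht => ⟨v, ?_⟩⟩
    exact (Finset.subset_singleton_iff.mp hts).resolve_left ht.ne_empty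

/-- The part of a set `s` of vertices of a join that lies in the `j`-th copy. -/
def slice {ι V : Type*} [DecidableEq ι] [DecidableEq V] (s : Finset (ι × V)) (j : ι) : Finset V :=
  (s.filter fun p => p.1 = j).image Prod.snd

/-- The `m`-fold join `K * ... * K`: its vertices are pairs `(j, v)` (the vertex `v` in the `j`-th
copy of `K`), and a nonempty finite set of vertices is a simplex if for each `j` its part in the
`j`-th copy is empty or a simplex of `K`. -/
def joinPower {V : Type*} [DecidableEq V] (m : ℕ) (K : PreAbstractSimplicialComplex V) :
    PreAbstractSimplicialComplex (Fin m × V) where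
  faces := {s | s.Nonempty ∧ ∀ j, slice s j = ∅ ∨ slice s j ∈ K.faces}
  isRelLowerSet_faces := by
    rintro s ⟨hs, h⟩
    refine ⟨hs, fun t hts ht => ⟨ht, fun j => ?_⟩⟩
    have hsub : slice t j ⊆ slice s j :=
      Finset.image_subset_image (Finset.filter_subset_filter _ hts)
    rcases Finset.eq_empty_or_nonempty (slice t j) with h0 | h0
    · exact Or.inl h0
    · refine Or.inr ?_
      rcases h j with h1 | h1
      · exact absurd (Finset.subset_empty.mp (h1 ▸ hsub)) h0.ne_empty
      · exact (K.isRelLowerSet_faces h1).2 hsub h0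

/-- The complex `(ℤ_k)^{*m}`, the `m`-fold join of the discrete set `ℤ_k`. -/
def zkJoin (k m : ℕ) : PreAbstractSimplicialComplex (Fin m × ZMod k) :=
  joinPower m (discreteComplex (ZMod k))

/-- The simplex `⟨i_1, ..., i_m⟩` of `(ℤ_k)^{*m}`, with vertex `i_j` in the `j`-th copy. -/
def tupleSimplex {k m : ℕ} (i : Fin m → ZMod k) : Finset (Fin m × ZMod k) :=
  Finset.univ.image fun j => (j, i j)

/-- The number of jumps `#{j ∈ [m-1] : i_j ≠ i_{j+1}}` of a tuple `(i_1, ..., i_m)`. -/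
def jumps {k m : ℕ} (i : Fin m → ZMod k) : ℕ :=
  (Finset.univ.filter fun j : Fin (m - 1) =>
    i ⟨j.1, by omega⟩ ≠ i ⟨j.1 + 1, by omega⟩).card

/-- The complex `(ℤ_k)^{*m}_{alt ≤ d}`: its simplices are the nonempty faces of the simplices
`⟨i_1, ..., i_m⟩` with at most `d` jumps. -/
def zkJoinAlt (k m d : ℕ) : PreAbstractSimplicialComplex (Fin m × ZMod k) where
  faces := {s | s.Nonempty ∧ ∃ i : Fin m → ZMod k, jumps i ≤ d ∧ s ⊆ tupleSimplex i}
  isRelLowerSet_faces := by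
    rintro s ⟨hs, i, hi, hsi⟩
    exact ⟨hs, fun t hts ht => ⟨ht, i, hi, hts.trans hsi⟩⟩

/-- The action of `ℤ_k` on the vertices `(j, s)` of `(ℤ_k)^{*m}`: `g` shifts the sign `s`. -/
def shift {k m : ℕ} (g : ZMod k) (p : Fin m × ZMod k) : Fin m × ZMod k :=
  (p.1, g + p.2)

/-- The linear action of `ℤ_k` on the space spanned by the vertices of `(ℤ_k)^{*m}`. On the
geometric realization of `(ℤ_k)^{*m}` this is the affine extension of the vertex action. -/
noncomputable def act {k m : ℕ} (g : ZMod k) :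
    (Fin m × ZMod k →₀ ℝ) →ₗ[ℝ] (Fin m × ZMod k →₀ ℝ) :=
  Finsupp.lmapDomain ℝ ℝ (shift g)

/-- The geometric complex `X` is a subdivision of the geometric complex `K`: each simplex of `X`
is contained in a simplex of `K`, and each simplex of `K` is the union of finitely many simplices
of `X`. -/
def IsSubdivision {E : Type*} [AddCommGroup E] [Module ℝ E]
    (X K : Geometry.SimplicialComplex ℝ E) : Prop :=
  (∀ s ∈ X.faces, ∃ t ∈ K.faces,
    convexHull ℝ (s : Set E) ⊆ convexHull ℝ (t : Set E)) ∧
  ∀ t ∈ K.faces, ∃ F : Set (Finset E), F.Finite ∧ F ⊆ X.faces ∧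
    convexHull ℝ (t : Set E) = ⋃ s ∈ F, convexHull ℝ (s : Set E)

/-- `X` is a `ℤ_k`-equivariant subdivision of `(ℤ_k)^{*m}`: it is a subdivision of the standard
geometric realization of `(ℤ_k)^{*m}`, and the action of `ℤ_k` maps simplices of `X` to
simplices of `X`. -/
def IsEquivariantSubdivision {k m : ℕ}
    (X : Geometry.SimplicialComplex ℝ (Fin m × ZMod k →₀ ℝ)) : Prop :=
  IsSubdivision X (Geometry.SimplicialComplex.onFinsupp (zkJoin k m)) ∧
  ∀ g : ZMod k, ∀ s ∈ X.faces, s.image (act g) ∈ X.faces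

/-- `f` is a simplicial map from `K` to `L`: it maps the vertex set of each simplex of `K` onto the
vertex set of a simplex of `L`. (Only the values of `f` at vertices of `K` matter.) -/
def IsSimplicialMap {V W : Type*} [DecidableEq W]
    (K : PreAbstractSimplicialComplex V) (L : PreAbstractSimplicialComplex W) (f : V → W) : Prop :=
  ∀ s ∈ K.faces, s.image f ∈ L.faces

end ZkTucker

/-! ### Cochains on ordered tuples and the bar cochains of the cyclic group. -/

namespace ZkTucker

/-! The obstruction is homological. The minimal free resolution of ℤ over ℤ[ℤ_k] has one generator
in each degree, and its differentials alternate between T - 1 and the norm. The cochains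
`barCochain` describe an equivariant chain map to it from the bar resolution, obtained by cupping
repeatedly with the carry cocycle (`coboundary_barCochain`). They are normalized: they vanish on
tuples with two equal neighbours (`barCochain_eq_zero`). In the other direction, iterated cones give
a chain map from the minimal resolution to the chains of the join, recorded by `conePairing`
(`conePairing_coboundary`).

A map ℓ would connect the two. Summing `barCochain` of the labels, with orientation signs, over the
simplices of X inside a simplex of the join gives `labelCochain`. It satisfies the same relations
(`coboundary_labelCochain`) by a combinatorial Stokes formula (`subdivisionPullback_coboundary`):
codimension-one faces of X interior to a simplex cancel, and only those on its boundary survive.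

The composite acts as a chain self-map of the minimal resolution in degrees up to d + 1, and modulo
k its augmentation is the same in all these degrees (`conePairing_norm_modEq`). In degree 0 it is 1.
In degree d + 1 it is 0: a simplex with d + 2 vertices, sorted by the first coordinates of their
labels, has at most d jumps, so two neighbouring signs agree and the normalized cochain vanishes
(`barCochain_eq_zero_of_jumps`). Hence k divides 1. -/

/-- The coboundary of a cochain on ordered tuples. -/
def coboundary {W : Type*} (n : ℕ) (A : (Fin (n + 1) → W) → ℤ) : (Fin (n + 2) → W) → ℤ :=
  fun s => ∑ j : Fin (n + 2), (-1) ^ (j : ℕ) * A (s ∘ j.succAbove)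

/-- The operator `T - 1` (for even `n`) or `∑ g, g` (for odd `n`) of the minimal resolution of the
cyclic group, acting on cochains. -/
def resolutionOp {k : ℕ} [NeZero k] {W : Type*} (a : ZMod k → W → W) (n r : ℕ)
    (A : (Fin r → W) → ℤ) : (Fin r → W) → ℤ :=
  fun s => if Even n then A (a 1 ∘ s) - A s else ∑ g, A (a g ∘ s)

/-- The carry in the addition of the representatives of two residues. -/
def carry {k : ℕ} (x y : ZMod k) : ℤ := if k ≤ x.val + y.val then 1 else 0

/-- Over ℚ the carry is the coboundary of `val / k`. Identities between carries are therefore proved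
by multiplying by k, substituting this formula and cancelling k. -/
lemma carry_spec {k : ℕ} [NeZero k] (x y : ZMod k) :
    (k : ℤ) * carry x y = x.val + y.val - (x + y).val := by
  unfold carry
  split_ifs with h
  · have := ZMod.val_add_val_of_le h
    omega
  · rw [ZMod.val_add_of_lt (by omega)]; push_cast; ring

lemma carry_zero_left {k : ℕ} [NeZero k] (y : ZMod k) : carry 0 y = 0 := by
  have := y.val_lt
  simp [carry, this]

lemma carry_zero_right {k : ℕ} [NeZero k] (x : ZMod k) : carry x 0 = 0 := by
  have := x.val_lt
  simp [carry, this]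

lemma val_sub_val_sub_one {k : ℕ} [NeZero k] (s : ZMod k) :
    (s.val : ℤ) - (s - 1).val = 1 - k * (if s = 0 then 1 else 0) := by
  obtain ⟨n, rfl⟩ : ∃ n, k = n + 1 := Nat.exists_eq_succ_of_ne_zero (NeZero.ne k)
  have h1 := carry_spec (s - 1) 1
  split_ifs with h
  · subst h
    simp [ZMod.val_neg_one]
  · rcases Nat.eq_zero_or_pos n with rfl | hn
    · exact absurd (Subsingleton.elim (α := Fin 1) s 0) h
    have h2 : (1 : ZMod (n + 1)).val = 1 := by
      have : Fact (1 < n + 1) := ⟨by omega⟩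
      exact ZMod.val_one _
    rw [sub_add_cancel, h2] at h1
    have h3 : 0 < s.val := by
      rw [Nat.pos_iff_ne_zero, Ne, ZMod.val_eq_zero]; exact h
    have h4 : (s - 1).val < n + 1 := ZMod.val_lt _
    unfold carry at h1
    split_ifs at h1
    · rw [h2] at *
      push_cast at *
      omega
    · push_cast at *
      omega

/-- The components of an equivariant chain map from the (homogeneous, normalized) bar resolution
of the cyclic group to its minimal resolution. -/
def barCochain {k : ℕ} : (n : ℕ) → (Fin (n + 1) → ZMod k) → ℤ
  | 0, s => if s 0 = 0 then 1 else 0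
  | 1, s => carry (s 0 - 1) (s 1 - s 0)
  | n + 2, s => carry (s 1 - s 0) (s 2 - s 1) * barCochain n fun i => s i.succ.succ

lemma sum_add_eq_zero {k : ℕ} [NeZero k] (x : ZMod k) :
    ∑ g : ZMod k, (if g + x = 0 then (1 : ℤ) else 0) = 1 := by
  simp [add_eq_zero_iff_eq_neg]

lemma carry_cocycle {k : ℕ} [NeZero k] (w x y z : ZMod k) :
    carry (y - x) (z - y) - carry (y - w) (z - y) + carry (x - w) (z - x)
      = carry (x - w) (y - x) := by
  have hk : (k : ℤ) ≠ 0 := by exact_mod_cast NeZero.ne k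
  apply mul_left_cancel₀ hk
  rw [mul_add, mul_sub]
  simp only [carry_spec, sub_add_sub_cancel']
  ring

/-- The Leibniz rule for the cup product with a cocycle of even degree. The first three faces
combine by `carry_cocycle` into the leading term of the coboundary of b. -/
lemma coboundary_cup {k n : ℕ} [NeZero k] (b : (Fin (n + 1) → ZMod k) → ℤ)
    (s : Fin (n + 4) → ZMod k) :
    coboundary (n + 2) (fun s => carry (s 1 - s 0) (s 2 - s 1) * b fun i => s i.succ.succ) s
      = carry (s 1 - s 0) (s 2 - s 1) * coboundary n b fun i => s i.succ.succ := by
  unfold coboundary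
  rw [Fin.sum_univ_succ, Fin.sum_univ_succ, Fin.sum_univ_succ, Fin.sum_univ_succ (n := n + 1)]
  have h := carry_cocycle (s 0) (s 1) (s 2) (s 3)
  have e1 : ∀ r : ℕ, (1 : Fin (r + 2)) = Fin.succ 0 := fun _ => rfl
  have e2 : ∀ r : ℕ, (2 : Fin (r + 3)) = Fin.succ (Fin.succ 0) := fun _ => rfl
  have e3 : (3 : Fin (n + 4)) = Fin.succ (Fin.succ (Fin.succ 0)) := rfl
  simp only [e1, e2, e3] at h ⊢
  simp only [Function.comp_def, Fin.succ_succAbove_succ, Fin.succ_succAbove_zero,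
    Fin.zero_succAbove, Fin.val_zero, Fin.val_succ, mul_add, Finset.mul_sum]
  rw [← h]
  simp only [← add_assoc]
  congr 1
  · ring
  · refine Finset.sum_congr rfl fun i _ => ?_
    ring

/-- The resolution has period two and cupping with the carry class shifts degree by two, so only
degrees 0 and 1 need computation. The carry factor depends on differences only, hence commutes with
translation. -/
lemma coboundary_barCochain {k : ℕ} [NeZero k] : ∀ (n : ℕ) (s : Fin (n + 2) → ZMod k),
    coboundary n (barCochain n) s
      = resolutionOp (fun g x => g + x) n (n + 2) (barCochain (n + 1)) s
  | 0, s => by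
    have hk : (k : ℤ) ≠ 0 := by exact_mod_cast NeZero.ne k
    apply mul_left_cancel₀ hk
    have h0 := val_sub_val_sub_one (s 0)
    have h1 := val_sub_val_sub_one (s 1)
    have e : coboundary 0 (barCochain 0) s
        = (if s 1 = 0 then 1 else 0) - if s 0 = 0 then 1 else 0 := by
      simp only [coboundary]
      rw [Fin.sum_univ_two]
      change (-1) ^ 0 * (if s 1 = 0 then (1 : ℤ) else 0) + (-1) ^ 1 * (if s 0 = 0 then 1 else 0) = _
      ring
    have e' : resolutionOp (fun g x => g + x) 0 2 (barCochain 1) s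
        = carry (s 0) (s 1 - s 0) - carry (s 0 - 1) (s 1 - s 0) := by
      simp [resolutionOp, barCochain]
    rw [e, e', mul_sub, mul_sub, carry_spec, carry_spec, sub_add_sub_cancel', add_sub_cancel]
    linarith
  | 1, s => by
    have e : coboundary 1 (barCochain 1) s = carry (s 1 - 1) (s 2 - s 1)
        - carry (s 0 - 1) (s 2 - s 0) + carry (s 0 - 1) (s 1 - s 0) := by
      simp only [coboundary]
      rw [Fin.sum_univ_three]
      simp [barCochain, sub_eq_add_neg, show Fin.succAbove (2 : Fin 3) 1 = 1 from rfl]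
    have e' : resolutionOp (fun g x => g + x) 1 3 (barCochain 2) s
        = carry (s 1 - s 0) (s 2 - s 1) := by
      rw [resolutionOp, if_neg (by decide)]
      simp only [barCochain, Function.comp, add_sub_add_left_eq_sub, ← Finset.mul_sum]
      rw [sum_add_eq_zero, mul_one]
    have hk : (k : ℤ) ≠ 0 := by exact_mod_cast NeZero.ne k
    rw [e, e']
    apply mul_left_cancel₀ hk
    rw [mul_add, mul_sub]
    simp only [carry_spec, sub_add_sub_cancel']
    ring
  | n + 2, s => by
    have h := coboundary_cup (barCochain n) s
    have h' := coboundary_barCochain n fun i => s i.succ.succ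
    rw [show coboundary (n + 2) (barCochain (n + 2)) s = _ from h, h']
    simp only [resolutionOp, Nat.even_add, even_two, iff_true]
    split_ifs
    · simp [barCochain, Function.comp_def]; ring
    · simp [barCochain, Function.comp_def, Finset.mul_sum]

/-- Normalization: adding 0 never carries. This property disposes both of ties in the ordering of
vertices and of tuples with too few jumps. -/
lemma barCochain_eq_zero {k : ℕ} [NeZero k] : ∀ (n : ℕ) (s : Fin (n + 1) → ZMod k) (j : ℕ)
    (hj : j + 1 < n + 1), s ⟨j, by omega⟩ = s ⟨j + 1, hj⟩ → barCochain n s = 0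
  | 0, s, j, hj, h => by omega
  | 1, s, j, hj, h => by
    obtain rfl : j = 0 := by omega
    have : s 1 = s 0 := h.symm
    simp [barCochain, this, carry_zero_right]
  | n + 2, s, 0, hj, h => by
    have : s 1 = s 0 := h.symm
    simp [barCochain, this, carry_zero_left]
  | n + 2, s, 1, hj, h => by
    have : s 2 = s 1 := h.symm
    simp [barCochain, this, carry_zero_right]
  | n + 2, s, j + 2, hj, h => by
    have := barCochain_eq_zero n (fun i => s i.succ.succ) j (by omega) h
    simp [barCochain, this]

/-! ### Cone chains in the join and the invariance of augmentations modulo k. -/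

section Pairing

variable {k : ℕ} {d : ℕ}

/-- A functional on `n`-cochains of the join: evaluation at the image, under the standard cone
construction, of the generator of degree `n` of the minimal resolution. -/
def conePairing [NeZero k] : (n : ℕ) → ((Fin (n + 1) → Fin (d + 2) × ZMod k) → ℤ) → ℤ
  | 0, A => A fun _ => (0, 0)
  | n + 1, A => conePairing n (resolutionOp shift n (n + 1) fun t =>
      A (Fin.cons (Fin.ofNat (d + 2) (n + 1), 0) t))

/-- Tuples of vertices of the join in decreasing order of first coordinates, which are at most
`n`. -/
def IsConeTuple (n : ℕ) (t : Fin (n + 1) → Fin (d + 2) × ZMod k) : Prop :=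
  (∀ i, ((t i).1 : ℕ) ≤ n) ∧ Function.Injective fun i => (t i).1

lemma shift_zero {m : ℕ} (p : Fin m × ZMod k) : shift 0 p = p := by simp [shift]

lemma shift_shift {m : ℕ} (g h : ZMod k) (p : Fin m × ZMod k) :
    shift g (shift h p) = shift (g + h) p := by simp [shift, add_assoc]

lemma IsConeTuple.shift {n : ℕ} {t : Fin (n + 1) → Fin (d + 2) × ZMod k} (h : IsConeTuple n t)
    (g : ZMod k) : IsConeTuple n (shift g ∘ t) := h

lemma IsConeTuple.cons {n : ℕ} (hn : n ≤ d) {t : Fin (n + 1) → Fin (d + 2) × ZMod k}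
    (h : IsConeTuple n t) :
    IsConeTuple (n + 1)
      (Fin.cons (Fin.ofNat (d + 2) (n + 1), 0) t : Fin (n + 2) → Fin (d + 2) × ZMod k) := by
  have hv : ((Fin.ofNat (d + 2) (n + 1) : Fin (d + 2)) : ℕ) = n + 1 := by
    simp [Fin.ofNat, Nat.mod_eq_of_lt (show n + 1 < d + 2 by omega)]
  refine ⟨fun i => ?_, fun i j => ?_⟩
  · refine Fin.cases ?_ (fun i => ?_) i
    · exact hv.le
    · simpa using (h.1 i).trans (Nat.le_succ n)
  · refine Fin.cases ?_ (fun i => ?_) i <;> refine Fin.cases ?_ (fun j => ?_) j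
    · simp
    · intro e
      have := congrArg Fin.val e
      simp only [Fin.cons_zero, Fin.cons_succ, hv] at this
      have := h.1 j
      omega
    · intro e
      have := congrArg Fin.val e
      simp only [Fin.cons_zero, Fin.cons_succ, hv] at this
      have := h.1 i
      omega
    · intro e
      simp only [Fin.cons_succ] at e
      rw [h.2 e]

variable [NeZero k]

/-- The cone chains are supported on genuine simplices of the join, as each apex lies in a new copy.
The bound on n keeps `Fin.ofNat` from wrapping around. -/
lemma conePairing_congr : ∀ {n : ℕ} (_ : n ≤ d + 1)
    {A B : (Fin (n + 1) → Fin (d + 2) × ZMod k) → ℤ} (_ : ∀ t, IsConeTuple n t → A t = B t),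
    conePairing n A = conePairing n B
  | 0, _, A, B, h => h _ ⟨fun _ => by simp, fun i j _ => Subsingleton.elim (α := Fin 1) i j⟩
  | n + 1, hn, A, B, h => by
    change conePairing n _ = conePairing n _
    refine conePairing_congr (by omega) fun t ht => ?_
    have h' : ∀ t, IsConeTuple n t → A (Fin.cons (Fin.ofNat (d + 2) (n + 1), 0) t)
        = B (Fin.cons (Fin.ofNat (d + 2) (n + 1), 0) t) :=
      fun t ht => h _ (ht.cons (by omega))
    simp only [resolutionOp, h' t ht, fun g => h' _ (ht.shift g)]

lemma resolutionOp_add {W : Type*} (a : ZMod k → W → W) (n r : ℕ) (A B : (Fin r → W) → ℤ) :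
    resolutionOp a n r (A + B) = resolutionOp a n r A + resolutionOp a n r B := by
  funext s
  simp only [resolutionOp, Pi.add_apply]
  split_ifs
  · ring
  · rw [Finset.sum_add_distrib]

lemma conePairing_add : ∀ (n : ℕ) (A B : (Fin (n + 1) → Fin (d + 2) × ZMod k) → ℤ),
    conePairing n (A + B) = conePairing n A + conePairing n B
  | 0, A, B => rfl
  | n + 1, A, B => by
    simp only [conePairing]
    rw [← conePairing_add n, ← resolutionOp_add]
    rfl

/-- `conePairing` as an additive map. -/
def conePairingHom (n : ℕ) : ((Fin (n + 1) → Fin (d + 2) × ZMod k) → ℤ) →+ ℤ :=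
  AddMonoidHom.mk' (conePairing n) (conePairing_add n)

lemma coboundary_resolutionOp {W : Type*} (a : ZMod k → W → W) (n r : ℕ)
    (A : (Fin (n + 1) → W) → ℤ) :
    coboundary n (resolutionOp a r (n + 1) A) = resolutionOp a r (n + 2) (coboundary n A) := by
  funext s
  simp only [coboundary, resolutionOp]
  split_ifs
  · simp only [mul_sub, Finset.sum_sub_distrib, Function.comp_assoc]
  · simp only [Finset.mul_sum, Function.comp_assoc]
    rw [Finset.sum_comm]

lemma resolutionOp_resolutionOp_succ (n r : ℕ)
    (A : (Fin r → Fin (d + 2) × ZMod k) → ℤ) :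
    resolutionOp shift n r (resolutionOp shift (n + 1) r A) = 0 := by
  have key : ∀ (s : Fin r → Fin (d + 2) × ZMod k),
      ∑ g : ZMod k, A (shift g ∘ (shift 1 ∘ s)) = ∑ g : ZMod k, A (shift g ∘ s) := by
    intro s
    refine Fintype.sum_equiv (Equiv.addRight 1) _ _ fun g => ?_
    congr 1
    funext i
    simp [shift_shift]
  have key' : ∀ (s : Fin r → Fin (d + 2) × ZMod k),
      ∑ g : ZMod k, A (shift 1 ∘ (shift g ∘ s)) = ∑ g : ZMod k, A (shift g ∘ s) := by
    intro s
    refine Fintype.sum_equiv (Equiv.addLeft 1) _ _ fun g => ?_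
    congr 1
    funext i
    simp [shift_shift]
  funext s
  by_cases h : Even n
  · simp [resolutionOp, h, Nat.even_add_one, key]
  · simp [resolutionOp, h, Nat.even_add_one, key', Finset.sum_sub_distrib]

/-- The boundary formula for the chains defining `conePairing`. -/
lemma conePairing_coboundary : ∀ (n : ℕ) (A : (Fin (n + 1) → Fin (d + 2) × ZMod k) → ℤ),
    conePairing (n + 1) (coboundary n A) = conePairing n (resolutionOp shift n (n + 1) A)
  | 0, A => by
    simp only [conePairing, resolutionOp, Even.zero, if_true]
    simp only [coboundary]
    rw [Fin.sum_univ_two, Fin.sum_univ_two]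
    have e : ∀ (v : Fin (d + 2) × ZMod k) (t : Fin 1 → Fin (d + 2) × ZMod k),
        (Fin.cons v t : Fin 2 → _) ∘ (Fin.succAbove 1) = fun _ => v := by
      intro v t; funext i; fin_cases i; rfl
    have e' : ∀ (v : Fin (d + 2) × ZMod k) (t : Fin 1 → Fin (d + 2) × ZMod k),
        (Fin.cons v t : Fin 2 → _) ∘ (Fin.succAbove 0) = t := by
      intro v t; funext i; fin_cases i; rfl
    rw [e, e, e', e', Fin.val_zero, Fin.val_one]
    ring
  | n + 1, A => by
    -- Dual to ∂(v * c) = c - v * ∂c.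
    have e : (fun t => coboundary (n + 1) A
          (Fin.cons (Fin.ofNat (d + 2) (n + 1 + 1), 0) t : Fin (n + 3) → _))
        = A - coboundary n fun t => A (Fin.cons (Fin.ofNat (d + 2) (n + 1 + 1), 0) t) := by
      funext t
      simp only [coboundary, Pi.sub_apply]
      rw [Fin.sum_univ_succ, sub_eq_add_neg, ← Finset.sum_neg_distrib]
      congr 1
      · simp [Function.comp_def]
      · refine Finset.sum_congr rfl fun j _ => ?_
        have : (Fin.cons (Fin.ofNat (d + 2) (n + 1 + 1), 0) t : Fin (n + 3) → _) ∘ j.succ.succAbove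
            = (Fin.cons (Fin.ofNat (d + 2) (n + 1 + 1), 0) (t ∘ j.succAbove) :
              Fin (n + 2) → Fin (d + 2) × ZMod k) := by
          funext i
          refine Fin.cases ?_ (fun i => ?_) i <;> simp
        rw [this, Fin.val_succ, pow_succ]
        ring
    have hz : conePairing n (0 : (Fin (n + 1) → Fin (d + 2) × ZMod k) → ℤ) = 0 :=
      (conePairingHom n).map_zero
    rw [conePairing, e]
    set B : (Fin (n + 1) → Fin (d + 2) × ZMod k) → ℤ :=
      fun t => A (Fin.cons (Fin.ofNat (d + 2) (n + 1 + 1), 0) t) with hB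
    -- The base of the cone is a cycle: by induction its boundary involves the composite of two
    -- consecutive differentials of the resolution.
    have h1 : conePairing (n + 1) (resolutionOp shift (n + 1) (n + 2) (coboundary n B)) = 0 := by
      rw [← coboundary_resolutionOp, conePairing_coboundary n,
        resolutionOp_resolutionOp_succ, hz]
    have h2 := conePairing_add (n + 1) (resolutionOp shift (n + 1) (n + 2) (A - coboundary n B))
      (resolutionOp shift (n + 1) (n + 2) (coboundary n B))
    rw [← resolutionOp_add, sub_add_cancel, h1, add_zero] at h2
    exact h2.symm

/-- The augmentations, modulo `k`, of the components of a chain map of resolutions agree in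
consecutive degrees. -/
lemma conePairing_norm_modEq {n : ℕ} (hn : n ≤ d)
    (A : (Fin (n + 1) → Fin (d + 2) × ZMod k) → ℤ)
    (B : (Fin (n + 2) → Fin (d + 2) × ZMod k) → ℤ)
    (h : ∀ t, IsConeTuple (n + 1) t →
      coboundary n A t = resolutionOp shift n (n + 2) B t) :
    ∑ g : ZMod k, conePairing n (fun t => A (shift g ∘ t))
      ≡ ∑ g : ZMod k, conePairing (n + 1) (fun t => B (shift g ∘ t)) [ZMOD k] := by
  have hsum : ∀ (r : ℕ) (C : (Fin (r + 1) → Fin (d + 2) × ZMod k) → ℤ),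
      ∑ g : ZMod k, conePairing r (fun t => C (shift g ∘ t))
        = conePairing r (fun t => ∑ g : ZMod k, C (shift g ∘ t)) := by
    intro r C
    have := map_sum (conePairingHom (d := d) r) (fun (g : ZMod k) t => C (shift g ∘ t)) Finset.univ
    refine this.symm.trans (congrArg (conePairing r) ?_)
    funext t
    simp
  by_cases hev : Even n
  · set f : ZMod k → ℤ := fun g => conePairing n (fun t => A (shift g ∘ t)) with hf
    set f' : ZMod k → ℤ := fun g => conePairing (n + 1) (fun t => B (shift g ∘ t)) with hf'
    -- For the differential T - 1 the chain map condition says that f and f' have equal increments.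
    -- Since 1 generates ℤ_k, they differ by a constant, which contributes k times itself to the
    -- sum.
    have step : ∀ g, f (g + 1) - f g = f' (g + 1) - f' g := by
      intro g
      have hsub : ∀ (r : ℕ) (C : (Fin (r + 1) → Fin (d + 2) × ZMod k) → ℤ),
          conePairing r (fun t => C (shift (g + 1) ∘ t)) - conePairing r (fun t => C (shift g ∘ t))
            = conePairing r (resolutionOp shift n (r + 1) fun t => C (shift g ∘ t)) := by
        intro r C
        refine ((conePairingHom (d := d) r).map_sub _ _).symm.trans (congrArg (conePairing r) ?_)
        funext t
        simp only [resolutionOp, hev, if_true, Pi.sub_apply]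
        congr 2
        funext i
        simp [shift_shift]
      rw [hf, hf']
      simp only
      rw [hsub n A, hsub (n + 1) B, ← conePairing_coboundary]
      refine conePairing_congr (by omega) fun t ht => ?_
      have h1 := h _ (ht.shift g)
      have h2 : coboundary n (fun t => A (shift g ∘ t)) t = coboundary n A (shift g ∘ t) := rfl
      rw [h2, h1]
      simp only [resolutionOp, hev, if_true]
      congr 2
      funext i
      simp [shift_shift, add_comm]
    have const : ∀ i : ℕ, f' (i : ZMod k) - f (i : ZMod k) = f' 0 - f 0 := by
      intro i
      induction i with
      | zero => simp
      | succ i ih =>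
        have := step i
        push_cast
        linarith
    have hall : ∀ g, f' g = f g + (f' 0 - f 0) := by
      intro g
      have := const g.val
      rw [ZMod.natCast_zmod_val] at this
      linarith
    rw [Finset.sum_congr rfl fun g _ => hall g, Finset.sum_add_distrib]
    simp [Int.modEq_iff_dvd, ← mul_sub]
  · rw [hsum, hsum]
    have e : ∀ (r : ℕ) (C : (Fin (r + 1) → Fin (d + 2) × ZMod k) → ℤ),
        (fun t => ∑ g : ZMod k, C (shift g ∘ t)) = resolutionOp shift n (r + 1) C := by
      intro r C; funext t; simp [resolutionOp, hev]
    rw [e, e, ← conePairing_coboundary, conePairing_congr (by omega) h]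

end Pairing

/-! ### Orientations, and the cofaces of a codimension-one face in a subdivided simplex. -/

section Geometry

variable {V : Type*} {r n : ℕ}

/-- The geometric simplex in `V →₀ ℝ` spanned by the vertices of an ordered tuple. -/
def simplexHull (t : Fin r → V) : Set (V →₀ ℝ) :=
  convexHull ℝ (Set.range fun i => Finsupp.single (t i) (1 : ℝ))

lemma mem_simplexHull {t : Fin r → V} (ht : Function.Injective t) {x : V →₀ ℝ} :
    x ∈ simplexHull t ↔
      (∀ i, 0 ≤ x (t i)) ∧ (∀ v, v ∉ Set.range t → x v = 0) ∧ ∑ i, x (t i) = 1 := by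
  classical
  constructor
  · intro hx
    refine convexHull_min (t := {x : V →₀ ℝ | (∀ i, 0 ≤ x (t i)) ∧
      (∀ v, v ∉ Set.range t → x v = 0) ∧ ∑ i, x (t i) = 1}) ?_ ?_ hx
    · rintro _ ⟨j, rfl⟩
      refine ⟨fun i => ?_, fun v hv => ?_, ?_⟩
      · simp only [Finsupp.single_apply]; split_ifs <;> norm_num
      · exact Finsupp.single_eq_of_ne fun h => hv ⟨j, h.symm⟩
      · simp [Finsupp.single_apply, ht.eq_iff]
    · rintro x ⟨h1, h2, h3⟩ y ⟨h1', h2', h3'⟩ a b ha hb hab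
      refine ⟨fun i => ?_, fun v hv => ?_, ?_⟩
      · have := h1 i; have := h1' i
        simp only [Finsupp.add_apply, Finsupp.smul_apply, smul_eq_mul]; positivity
      · simp [h2 v hv, h2' v hv]
      · simp [Finset.sum_add_distrib, ← Finset.mul_sum, h3, h3', hab]
  · rintro ⟨h1, h2, h3⟩
    have hx : x = ∑ i, x (t i) • Finsupp.single (t i) (1 : ℝ) := by
      ext v
      by_cases hv : v ∈ Set.range t
      · obtain ⟨j, rfl⟩ := hv
        simp [Finsupp.finsetSum_apply, Finsupp.single_apply, ht.eq_iff]
      · rw [h2 v hv, Finsupp.finsetSum_apply]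
        refine (Finset.sum_eq_zero fun i _ => ?_).symm
        have : t i ≠ v := fun h => hv ⟨i, h⟩
        simp [this]
    rw [hx]
    exact (convex_convexHull ℝ _).sum_mem (fun i _ => h1 i) h3
      fun i _ => subset_convexHull ℝ _ ⟨i, rfl⟩

lemma eq_of_mem_span_coords {t : Fin r → V} {x y : V →₀ ℝ}
    (hx : ∀ v, v ∉ Set.range t → x v = 0) (hy : ∀ v, v ∉ Set.range t → y v = 0)
    (h : ∀ i, x (t i) = y (t i)) : x = y := by
  ext v
  by_cases hv : v ∈ Set.range t
  · obtain ⟨i, rfl⟩ := hv; exact h i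
  · rw [hx v hv, hy v hv]

/-- The determinant of the coordinates of the points `p` with respect to the vertices `t`. -/
noncomputable def detAt (t : Fin r → V) (p : Fin r → V →₀ ℝ) : ℝ :=
  (Matrix.of fun i j => p i (t j)).det

/-- Laplace expansion of `detAt` along the first point, as a linear form in that point. -/
noncomputable def facetForm (t : Fin (n + 1) → V) (q : Fin n → V →₀ ℝ) : (V →₀ ℝ) →ₗ[ℝ] ℝ :=
  ∑ i : Fin (n + 1), ((-1) ^ (i : ℕ) * detAt (t ∘ i.succAbove) q) • Finsupp.lapply (t i)

lemma facetForm_apply (t : Fin (n + 1) → V) (q : Fin n → V →₀ ℝ) (x : V →₀ ℝ) :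
    facetForm t q x = ∑ i : Fin (n + 1), (-1) ^ (i : ℕ) * detAt (t ∘ i.succAbove) q * x (t i) := by
  simp [facetForm, LinearMap.sum_apply]

lemma detAt_cons (t : Fin (n + 1) → V) (q : Fin n → V →₀ ℝ) (x : V →₀ ℝ) :
    detAt t (Fin.cons x q : Fin (n + 1) → V →₀ ℝ) = facetForm t q x := by
  rw [detAt, Matrix.det_succ_row_zero, facetForm_apply]
  refine Finset.sum_congr rfl fun i _ => ?_
  have : (Matrix.of fun i j => (Fin.cons x q : Fin (n + 1) → V →₀ ℝ) i (t j)).submatrix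
      Fin.succ i.succAbove = Matrix.of fun i' j => q i' ((t ∘ i.succAbove) j) := by
    ext a b; simp
  rw [this, detAt]
  simp only [Matrix.of_apply, Fin.cons_zero]
  ring

/-- The determinant has a repeated row. Thus, when nonzero on the span of t, the form cuts out there
the hyperplane through the points q, and its sign tells the two sides apart. -/
lemma facetForm_apply_point (t : Fin (n + 1) → V) (q : Fin n → V →₀ ℝ) (j : Fin n) :
    facetForm t q (q j) = 0 := by
  rw [← detAt_cons]
  refine Matrix.det_zero_of_row_eq (Fin.succ_ne_zero j).symm ?_
  funext i
  simp

lemma facetForm_single {t : Fin (n + 1) → V} (ht : Function.Injective t) (q : Fin n → V →₀ ℝ)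
    (i : Fin (n + 1)) :
    facetForm t q (Finsupp.single (t i) 1) = (-1) ^ (i : ℕ) * detAt (t ∘ i.succAbove) q := by
  classical
  rw [facetForm_apply]
  simp [Finsupp.single_apply, ht.eq_iff]

lemma detAt_facet_eq_zero (t : Fin (n + 1) → V) (q : Fin n → V →₀ ℝ) {i j : Fin (n + 1)}
    (hij : j ≠ i) (h : ∀ a, q a (t i) = 0) : detAt (t ∘ j.succAbove) q = 0 := by
  obtain ⟨i', rfl⟩ := Fin.exists_succAbove_eq hij.symm
  exact Matrix.det_eq_zero_of_column_eq_zero i' fun a => h a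

lemma exists_combination_of_detAt_ne_zero {t : Fin r → V} {p : Fin r → V →₀ ℝ}
    (h : detAt t p ≠ 0) (hp : ∀ a v, v ∉ Set.range t → p a v = 0) {w : V →₀ ℝ}
    (hw : ∀ v, v ∉ Set.range t → w v = 0) : ∃ c : Fin r → ℝ, w = ∑ a, c a • p a := by
  set M : Matrix (Fin r) (Fin r) ℝ := Matrix.of fun i j => p i (t j) with hM
  refine ⟨Matrix.vecMul (fun i => w (t i)) M⁻¹, eq_of_mem_span_coords hw ?_ ?_⟩
  · intro v hv
    rw [Finsupp.finsetSum_apply]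
    exact Finset.sum_eq_zero fun a _ => by simp [hp a v hv]
  · intro i
    have h1 : Matrix.vecMul (Matrix.vecMul (fun i => w (t i)) M⁻¹) M = fun i => w (t i) := by
      rw [Matrix.vecMul_vecMul, Matrix.nonsing_inv_mul _ (isUnit_iff_ne_zero.mpr h),
        Matrix.vecMul_one]
    rw [Finsupp.finsetSum_apply]
    exact (congrFun h1 i).symm

variable {X : Geometry.SimplicialComplex ℝ (V →₀ ℝ)}

/-- The centroid also lies in the hull of s ∩ τ. All its barycentric coordinates in τ are positive,
and they are unique, so no vertex of τ is missing from s. -/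
lemma subset_of_centroid_mem {E : Type*} [AddCommGroup E] [Module ℝ E]
    {X : Geometry.SimplicialComplex ℝ E} {τ s : Finset E} (hτ : τ ∈ X.faces) (hs : s ∈ X.faces)
    (h : ∑ v ∈ τ, (τ.card : ℝ)⁻¹ • v ∈ convexHull ℝ (s : Set E)) : τ ⊆ s := by
  classical
  have hpos : (0 : ℝ) < τ.card := by
    exact_mod_cast (X.nonempty_of_mem_faces hτ).card_pos
  have hb : ∑ v ∈ τ, (τ.card : ℝ)⁻¹ • v ∈ convexHull ℝ (τ : Set E) :=
    (convex_convexHull ℝ _).sum_mem (fun _ _ => by positivity)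
      (by simp [hpos.ne']) fun v hv => subset_convexHull ℝ _ hv
  have hu := X.inter_subset_convexHull hs hτ ⟨h, hb⟩
  rw [← Finset.coe_inter, Finset.mem_convexHull'] at hu
  obtain ⟨w, hw0, hw1, hw⟩ := hu
  intro v hv
  by_contra hvs
  have hind := affineIndependent_iff.mp (X.indep hτ) Finset.univ
    (fun x => (τ.card : ℝ)⁻¹ - if (x : E) ∈ s then w x else 0)
  have e1 : ∑ x : τ, ((τ.card : ℝ)⁻¹ - if (x : E) ∈ s then w x else 0) = 0 := by
    rw [Finset.sum_coe_sort τ (fun x => (τ.card : ℝ)⁻¹ - if x ∈ s then w x else 0),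
      Finset.sum_sub_distrib, ← Finset.sum_filter, Finset.filter_mem_eq_inter, Finset.inter_comm,
      hw1]
    simp [hpos.ne']
  have e2 : ∑ x : τ, ((τ.card : ℝ)⁻¹ - if (x : E) ∈ s then w x else 0) • (x : E) = 0 := by
    rw [Finset.sum_coe_sort τ (fun x => ((τ.card : ℝ)⁻¹ - if x ∈ s then w x else 0) • x)]
    simp only [sub_smul, ite_smul, zero_smul]
    rw [Finset.sum_sub_distrib, ← Finset.sum_filter, Finset.filter_mem_eq_inter,
      Finset.inter_comm, hw, sub_self]
  have := hind e1 e2 ⟨v, hv⟩ (Finset.mem_univ _)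
  simp only [hvs, if_false, sub_zero, inv_eq_zero] at this
  exact hpos.ne' this

/-- The geometric complex `X` covers the simplex spanned by `t` by finitely many of its faces. -/
def Covers (X : Geometry.SimplicialComplex ℝ (V →₀ ℝ)) (t : Fin r → V) : Prop :=
  ∃ F : Set (Finset (V →₀ ℝ)), F.Finite ∧ F ⊆ X.faces ∧
    simplexHull t = ⋃ s ∈ F, convexHull ℝ (s : Set (V →₀ ℝ))

/-- The centroid of such a face lies in a member of the finite cover, so the face is a subset of
that member. -/
lemma Covers.finite {t : Fin r → V} (h : Covers X t) :
    {s ∈ X.faces | (s : Set (V →₀ ℝ)) ⊆ simplexHull t}.Finite := by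
  obtain ⟨F, hF, hFX, hcov⟩ := h
  refine (hF.biUnion fun s _ => s.powerset.finite_toSet).subset ?_
  rintro τ ⟨hτ, hτt⟩
  have hpos : (0 : ℝ) < τ.card := by
    exact_mod_cast (X.nonempty_of_mem_faces hτ).card_pos
  have hb : ∑ v ∈ τ, (τ.card : ℝ)⁻¹ • v ∈ simplexHull t :=
    (convex_convexHull ℝ _).sum_mem (fun _ _ => by positivity)
      (by simp [hpos.ne']) fun v hv => hτt hv
  rw [hcov] at hb
  simp only [Set.mem_iUnion] at hb ⊢
  obtain ⟨s, hs, hbs⟩ := hb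
  exact ⟨s, hs, by simpa using subset_of_centroid_mem hτ (hFX hs) hbs⟩

lemma exists_mem_pos_of_mem_convexHull {E : Type*} [AddCommGroup E] [Module ℝ E] {s : Set E}
    (L : E →ₗ[ℝ] ℝ) {x : E} (hx : x ∈ convexHull ℝ s) (h : 0 < L x) : ∃ v ∈ s, 0 < L v := by
  by_contra! hc
  exact absurd (convexHull_min (t := {y | L y ≤ 0}) hc (convex_halfSpace_le L.isLinear 0) hx)
    (not_le.mpr h)

/-- Points of a finite-dimensional polytope are detected along a segment. -/
lemma mem_convexHull_of_frequently [Finite V] (s : Finset (V →₀ ℝ)) (b c : V →₀ ℝ)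
    (h : ∃ᶠ N : ℕ in Filter.atTop,
      (1 - 1 / ((N : ℝ) + 1)) • b + (1 / ((N : ℝ) + 1)) • c ∈ convexHull ℝ (s : Set (V →₀ ℝ))) :
    b ∈ convexHull ℝ (s : Set (V →₀ ℝ)) := by
  have := Fintype.ofFinite V
  let e := Finsupp.linearEquivFunOnFinite ℝ ℝ V
  have himg : e '' convexHull ℝ (s : Set (V →₀ ℝ)) = convexHull ℝ (e '' (s : Set (V →₀ ℝ))) :=
    e.toLinearMap.image_convexHull _
  have hclosed : IsClosed (e '' convexHull ℝ (s : Set (V →₀ ℝ))) := by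
    rw [himg]
    exact ((s.finite_toSet.image e).isCompact_convexHull (𝕜 := ℝ)).isClosed
  have hlim : Filter.Tendsto (fun N : ℕ => (1 - 1 / ((N : ℝ) + 1)) • e b + (1 / ((N : ℝ) + 1)) • e c)
      Filter.atTop (nhds (e b)) := by
    have h0 := tendsto_one_div_add_atTop_nhds_zero_nat (𝕜 := ℝ)
    have := ((tendsto_const_nhds (x := (1 : ℝ))).sub h0).smul_const (e b) |>.add
      (h0.smul_const (e c))
    simpa using this
  have hmem := hclosed.mem_of_frequently_of_tendsto (h.mono fun N hN => ?_) hlim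
  · obtain ⟨y, hy, hyb⟩ := hmem
    rwa [← e.injective hyb]
  · exact ⟨_, hN, by simp⟩

/-- Move from the centroid of τ slightly towards a vertex on the positive side. One face of the
finite cover contains such points arbitrarily close to the centroid; it is closed, so it contains
the centroid, hence τ, and it has a vertex on the positive side. -/
lemma exists_link_pos [Finite V] [DecidableEq (V →₀ ℝ)] {t : Fin r → V} (hcov : Covers X t)
    {τ : Finset (V →₀ ℝ)} (hτ : τ ∈ X.faces)
    (hτt : (τ : Set (V →₀ ℝ)) ⊆ simplexHull t) (L : (V →₀ ℝ) →ₗ[ℝ] ℝ) (hL : ∀ v ∈ τ, L v = 0)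
    {i : Fin r} (hi : 0 < L (Finsupp.single (t i) 1)) :
    ∃ v, v ∉ τ ∧ insert v τ ∈ X.faces ∧
      v ∈ simplexHull t ∧ 0 < L v := by
  obtain ⟨F, hF, hFX, hcov⟩ := hcov
  have hpos : (0 : ℝ) < τ.card := by
    exact_mod_cast (X.nonempty_of_mem_faces hτ).card_pos
  set b : V →₀ ℝ := ∑ v ∈ τ, (τ.card : ℝ)⁻¹ • v with hb
  have hbt : b ∈ simplexHull t :=
    (convex_convexHull ℝ _).sum_mem (fun _ _ => by positivity)
      (by simp [hpos.ne']) fun v hv => hτt hv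
  have hLb : L b = 0 := by
    rw [hb, map_sum]
    exact Finset.sum_eq_zero fun v hv => by rw [map_smul, hL v hv, smul_zero]
  set x : ℕ → V →₀ ℝ := fun N =>
    (1 - 1 / ((N : ℝ) + 1)) • b + (1 / ((N : ℝ) + 1)) • Finsupp.single (t i) (1 : ℝ) with hx
  have hxt : ∀ N, x N ∈ simplexHull t := by
    intro N
    have h1 : (0 : ℝ) < N + 1 := by positivity
    refine (convex_convexHull ℝ _) hbt (subset_convexHull ℝ _ ⟨i, rfl⟩) ?_ (by positivity) (by ring)
    rw [sub_nonneg, div_le_one h1]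
    linarith [(Nat.cast_nonneg N : (0 : ℝ) ≤ N)]
  have hLx : ∀ N, 0 < L (x N) := by
    intro N
    simp only [hx, map_add, map_smul, hLb, smul_eq_mul, mul_zero, zero_add]
    positivity
  obtain ⟨s, hsF, hs⟩ : ∃ s ∈ F, ∃ᶠ N in Filter.atTop, x N ∈ convexHull ℝ (s : Set (V →₀ ℝ)) := by
    by_contra! hc
    have := (Filter.eventually_all_finite hF).mpr hc
    obtain ⟨N, hN⟩ := this.exists
    have h1 := hxt N
    rw [hcov] at h1
    simp only [Set.mem_iUnion] at h1
    obtain ⟨s, hs, h2⟩ := h1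
    exact hN s hs h2
  have hbs := mem_convexHull_of_frequently s b _ hs
  have hτs := subset_of_centroid_mem hτ (hFX hsF) hbs
  obtain ⟨N, hN⟩ := hs.exists
  obtain ⟨v, hvs, hv⟩ := exists_mem_pos_of_mem_convexHull L hN (hLx N)
  refine ⟨v, fun hvτ => hv.ne' (hL v hvτ), ?_, ?_, hv⟩
  · exact X.down_closed (hFX hsF) (Finset.insert_subset hvs hτs) (Finset.insert_nonempty _ _)
  · rw [hcov]
    simp only [Set.mem_iUnion]
    exact ⟨s, hsF, subset_convexHull ℝ _ hvs⟩

/-- Two cofaces on the same side overlap beyond their common face: pushing w far enough towards the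
points q gives a point y of both. If v ≠ w, then y would lie in the hull of the q's, where the form
vanishes. -/
lemma link_pos_unique [DecidableEq (V →₀ ℝ)] {t : Fin (n + 1) → V} (ht : Function.Injective t)
    {q : Fin n → V →₀ ℝ} (hqt : ∀ a, q a ∈ simplexHull t)
    {v w : V →₀ ℝ} (ε : ℝ)
    (hv : insert v (Finset.univ.image q) ∈ X.faces) (hw : insert w (Finset.univ.image q) ∈ X.faces)
    (hvt : v ∈ simplexHull t) (hwt : w ∈ simplexHull t)
    (hLv : 0 < ε * facetForm t q v) (hLw : 0 < ε * facetForm t q w) : v = w := by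
  by_contra hvw
  rw [mem_simplexHull ht] at hvt hwt
  have hqt' := fun a => (mem_simplexHull ht).mp (hqt a)
  obtain ⟨c, hc⟩ := exists_combination_of_detAt_ne_zero (t := t)
    (p := (Fin.cons v q : Fin (n + 1) → V →₀ ℝ)) (w := w)
    (by rw [detAt_cons]; exact right_ne_zero_of_mul hLv.ne')
    (by
      intro a u hu
      refine Fin.cases ?_ (fun a => ?_) a
      · exact hvt.2.1 u hu
      · exact (hqt' a).2.1 u hu) hwt.2.1
  rw [Fin.sum_univ_succ] at hc
  simp only [Fin.cons_zero, Fin.cons_succ] at hc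
  have hc0 : 0 < c 0 := by
    have h1 : facetForm t q w = c 0 * facetForm t q v := by
      conv_lhs => rw [hc]
      simp [map_sum, facetForm_apply_point]
    rw [h1, mul_left_comm] at hLw
    exact (pos_iff_pos_of_mul_pos hLw).mpr hLv
  have hcsum : 1 = c 0 + ∑ a : Fin n, c a.succ := by
    have h1 := hwt.2.2
    have h2 : ∀ i, w (t i) = c 0 * v (t i) + ∑ a : Fin n, c a.succ * q a (t i) := by
      intro i
      conv_lhs => rw [hc]
      simp
    simp only [h2] at h1
    rw [Finset.sum_add_distrib, ← Finset.mul_sum, hvt.2.2, Finset.sum_comm] at h1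
    simp only [← Finset.mul_sum, (hqt' _).2.2, mul_one] at h1
    exact h1.symm
  -- Adding weight M at every q makes all coefficients of w in terms of v and q nonnegative; S
  -- renormalizes the total weight to 1.
  obtain ⟨M, hM0, hM⟩ : ∃ M : ℝ, 0 ≤ M ∧ ∀ a : Fin n, 0 ≤ c a.succ + M := by
    refine ⟨∑ a : Fin n, |c a.succ|, Finset.sum_nonneg fun _ _ => abs_nonneg _, fun a => ?_⟩
    have := Finset.single_le_sum (f := fun a : Fin n => |c a.succ|)
      (fun _ _ => abs_nonneg _) (Finset.mem_univ a)
    have := neg_abs_le (c a.succ)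
    linarith
  set S : ℝ := 1 + n * M with hS
  have hSpos : 0 < S := by positivity
  set y : V →₀ ℝ := S⁻¹ • w + ∑ a, (S⁻¹ * M) • q a with hy
  have hy' : y = (S⁻¹ * c 0) • v + ∑ a : Fin n, (S⁻¹ * (c a.succ + M)) • q a := by
    rw [hy]
    conv_lhs => rw [hc]
    simp only [smul_add, Finset.smul_sum, smul_smul, mul_add, add_smul, Finset.sum_add_distrib,
      add_assoc]
  have hmem : ∀ (u : V →₀ ℝ) (α : ℝ) (β : Fin n → ℝ), 0 ≤ α → (∀ a, 0 ≤ β a) →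
      α + ∑ a, β a = 1 → α • u + ∑ a, β a • q a
        ∈ convexHull ℝ ((insert u (Finset.univ.image q) : Finset (V →₀ ℝ)) : Set (V →₀ ℝ)) := by
    intro u α β hα hβ h1
    have := (convex_convexHull ℝ
      ((insert u (Finset.univ.image q) : Finset (V →₀ ℝ)) : Set (V →₀ ℝ))).sum_mem
      (t := Finset.univ) (w := (Fin.cons α β : Fin (n + 1) → ℝ))
      (z := (Fin.cons u q : Fin (n + 1) → V →₀ ℝ)) ?_ ?_ ?_
    · simpa [Fin.sum_univ_succ] using this
    · intro a _
      refine Fin.cases hα (fun a => hβ a) a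
    · simpa [Fin.sum_univ_succ] using h1
    · intro a _
      refine subset_convexHull ℝ _ ?_
      refine Fin.cases ?_ (fun a => ?_) a <;> simp
  have hyw := hmem w S⁻¹ (fun _ => S⁻¹ * M) (by positivity) (fun _ => by positivity) (by
    simp only [Finset.sum_const, Finset.card_univ, Fintype.card_fin, nsmul_eq_mul]
    field_simp
    rw [hS])
  have hyv := hmem v (S⁻¹ * c 0) (fun a => S⁻¹ * (c a.succ + M)) (by positivity)
    (fun a => mul_nonneg (by positivity) (hM a)) (by
      rw [← Finset.mul_sum, ← mul_add, Finset.sum_add_distrib, ← add_assoc, ← hcsum]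
      simp only [Finset.sum_const, Finset.card_univ, Fintype.card_fin, nsmul_eq_mul]
      exact inv_mul_cancel₀ hSpos.ne')
  rw [← hy'] at hyv
  have hyq := X.inter_subset_convexHull hv hw ⟨hyv, hyw⟩
  have hLy : 0 < (ε • facetForm t q) y := by
    simp only [hy, LinearMap.smul_apply, map_add, map_sum, map_smul, facetForm_apply_point,
      smul_eq_mul, mul_zero, Finset.sum_const_zero, add_zero]
    exact mul_pos (inv_pos.mpr hSpos) hLw
  obtain ⟨u, ⟨hu1, hu2⟩, hu⟩ := exists_mem_pos_of_mem_convexHull _ hyq hLy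
  have huq : ∀ a, u ≠ q a := by
    rintro a rfl
    simp [facetForm_apply_point] at hu
  simp only [Finset.coe_insert, Finset.coe_image, Finset.coe_univ, Set.image_univ,
    Set.mem_insert_iff, Set.mem_range] at hu1 hu2
  rcases hu1 with rfl | ⟨a, ha⟩
  · rcases hu2 with h | ⟨a, ha⟩
    · exact hvw h
    · exact huq a ha.symm
  · exact huq a ha.symm

end Geometry

/-! ### The combinatorial Stokes formula for subdivided simplices. -/

section Stokes

variable {V : Type*} {r n : ℕ} {X : Geometry.SimplicialComplex ℝ (V →₀ ℝ)}

open Classical in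
/-- The faces of `X` with `s` vertices which are contained in the simplex spanned by `t`. -/
noncomputable def cells (X : Geometry.SimplicialComplex ℝ (V →₀ ℝ)) (t : Fin r → V) (s : ℕ) :
    Finset (Finset (V →₀ ℝ)) :=
  if h : {σ ∈ X.faces | (σ : Set (V →₀ ℝ)) ⊆ simplexHull t}.Finite then
    h.toFinset.filter fun σ => σ.card = s
  else ∅

lemma mem_cells {t : Fin r → V} (h : Covers X t) {s : ℕ} {σ : Finset (V →₀ ℝ)} :
    σ ∈ cells X t s ↔ σ ∈ X.faces ∧ (σ : Set (V →₀ ℝ)) ⊆ simplexHull t ∧ σ.card = s := by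
  rw [cells, dif_pos h.finite]
  simp [and_assoc]

/-- The vertices `v` for which `insert v τ` is a face of `X` in the simplex spanned by `t`. -/
noncomputable def link [DecidableEq (V →₀ ℝ)] (X : Geometry.SimplicialComplex ℝ (V →₀ ℝ))
    (t : Fin r → V) (τ : Finset (V →₀ ℝ)) : Finset (V →₀ ℝ) :=
  ((cells X t (τ.card + 1)).biUnion id).filter fun v => v ∉ τ ∧ insert v τ ∈ cells X t (τ.card + 1)

lemma mem_link [DecidableEq (V →₀ ℝ)] {t : Fin r → V} {τ : Finset (V →₀ ℝ)} {v : V →₀ ℝ} :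
    v ∈ link X t τ ↔ v ∉ τ ∧ insert v τ ∈ cells X t (τ.card + 1) := by
  simp only [link, Finset.mem_filter, Finset.mem_biUnion, id, and_iff_right_iff_imp]
  exact fun h => ⟨_, h.2, Finset.mem_insert_self _ _⟩

/-- The sign of a real number, as an integer. -/
noncomputable def isign (x : ℝ) : ℤ := (SignType.sign x : ℤ)

lemma isign_mul (x y : ℝ) : isign (x * y) = isign x * isign y := by
  simp [isign, sign_mul]

lemma isign_neg_one_pow (i : ℕ) : isign ((-1) ^ i) = (-1) ^ i := by
  induction i with
  | zero => simp [isign]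
  | succ i ih => rw [pow_succ, isign_mul, ih, pow_succ]; congr 1; simp [isign]

lemma isign_eq (x : ℝ) : isign x = (if 0 < x then 1 else 0) - if x < 0 then 1 else 0 := by
  rcases lt_trichotomy x 0 with h | rfl | h
  · simp [isign, h, h.not_gt]
  · simp [isign]
  · simp [isign, h, h.not_gt]

lemma sum_indicator_eq_of_unique {α : Type*} (s : Finset α) (p : α → Prop) [DecidablePred p]
    (Q : Prop) [Decidable Q] (h : Q ↔ ∃ v ∈ s, p v)
    (hu : ∀ v ∈ s, ∀ w ∈ s, p v → p w → v = w) :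
    ∑ v ∈ s, (if p v then (1 : ℤ) else 0) = if Q then 1 else 0 := by
  classical
  split_ifs with hQ
  · obtain ⟨v, hv, hpv⟩ := h.mp hQ
    rw [Finset.sum_eq_single_of_mem v hv fun w hw hwv => if_neg fun hpw => hwv (hu w hw v hv hpw hpv),
      if_pos hpv]
  · exact Finset.sum_eq_zero fun v hv => if_neg fun hpv => hQ (h.mpr ⟨v, hv, hpv⟩)

lemma facetForm_eq_sum_single (t : Fin (n + 1) → V) (ht : Function.Injective t)
    (q : Fin n → V →₀ ℝ) (x : V →₀ ℝ) :
    facetForm t q x = ∑ i, facetForm t q (Finsupp.single (t i) 1) * x (t i) := by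
  simp only [facetForm_single ht]
  exact facetForm_apply t q x

/-- The signed number of simplices of `X` in the simplex `t` which contain a simplex of
codimension one. -/
lemma sum_link_isign [Finite V] [DecidableEq (V →₀ ℝ)] {t : Fin (n + 2) → V}
    (ht : Function.Injective t) (hcov : Covers X t) {q : Fin (n + 1) → V →₀ ℝ}
    (hqX : Finset.univ.image q ∈ X.faces) (hqt : ∀ a, q a ∈ simplexHull t)
    [∀ i : Fin (n + 2), Decidable (∀ a, q a (t i) = 0)] :
    ∑ v ∈ link X t (Finset.univ.image q), isign (facetForm t q v)
      = ∑ i, if ∀ a, q a (t i) = 0 then isign (facetForm t q (Finsupp.single (t i) 1)) else 0 := by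
  classical
  set τ := Finset.univ.image q with hτ
  have hτt : (τ : Set (V →₀ ℝ)) ⊆ simplexHull t := by
    intro x hx
    obtain ⟨a, -, rfl⟩ := Finset.mem_image.mp hx
    exact hqt a
  have hlink : ∀ v, v ∈ link X t τ → insert v τ ∈ X.faces ∧ v ∈ simplexHull t := by
    intro v hv
    have := (mem_cells hcov).mp (mem_link.mp hv).2
    exact ⟨this.1, this.2.1 (by simp)⟩
  -- The factor ε, used with values 1 and -1, treats both sides of the hyperplane at once. On each
  -- side there is a unique coface exactly when the big simplex has a vertex there.
  have hex : ∀ ε : ℝ, (∃ i, 0 < ε * facetForm t q (Finsupp.single (t i) 1)) ↔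
      ∃ v ∈ link X t τ, 0 < ε * facetForm t q v := by
    intro ε
    constructor
    · rintro ⟨i, hi⟩
      obtain ⟨v, hv1, hv2, hv3, hv4⟩ := exists_link_pos hcov hqX hτt (ε • facetForm t q)
        (by
          intro v hv
          obtain ⟨a, -, rfl⟩ := Finset.mem_image.mp hv
          simp [facetForm_apply_point]) hi
      refine ⟨v, mem_link.mpr ⟨hv1, (mem_cells hcov).mpr ⟨hv2, ?_, Finset.card_insert_of_notMem hv1⟩⟩,
        hv4⟩
      rw [Finset.coe_insert]
      exact Set.insert_subset hv3 hτt
    · rintro ⟨v, hv, hpos⟩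
      by_contra! hc
      have hv' := ((mem_simplexHull ht).mp (hlink v hv).2).1
      rw [facetForm_eq_sum_single t ht, Finset.mul_sum] at hpos
      refine absurd hpos (not_lt.mpr (Finset.sum_nonpos fun i _ => ?_))
      rw [← mul_assoc]
      exact mul_nonpos_of_nonpos_of_nonneg (hc i) (hv' i)
  have huniq : ∀ ε : ℝ, ∀ v ∈ link X t τ, ∀ w ∈ link X t τ,
      0 < ε * facetForm t q v → 0 < ε * facetForm t q w → v = w := by
    intro ε v hv w hw h1 h2
    exact link_pos_unique ht hqt ε (hlink v hv).1 (hlink w hw).1 (hlink v hv).2 (hlink w hw).2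
      h1 h2
  simp only [isign_eq]
  rw [Finset.sum_sub_distrib,
    sum_indicator_eq_of_unique _ _ (∃ i, 0 < facetForm t q (Finsupp.single (t i) 1))
      (by simpa using hex 1) (by simpa using huniq 1),
    sum_indicator_eq_of_unique _ _ (∃ i, facetForm t q (Finsupp.single (t i) 1) < 0)
      (by simpa using hex (-1)) (by simpa using huniq (-1))]
  -- If the small face lies in the facet opposite `t i`, the form vanishes at all other vertices, so
  -- only the side of `t i` can contribute.
  by_cases hfacet : ∃ i, ∀ a, q a (t i) = 0
  · obtain ⟨i, hi⟩ := hfacet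
    have hzero : ∀ j, j ≠ i → facetForm t q (Finsupp.single (t j) 1) = 0 := by
      intro j hj
      rw [facetForm_single ht, detAt_facet_eq_zero t q hj hi, mul_zero]
    have hiff : ∀ p : ℝ → Prop, ¬ p 0 → ((∃ j, p (facetForm t q (Finsupp.single (t j) 1))) ↔
        p (facetForm t q (Finsupp.single (t i) 1))) := by
      intro p hp
      refine ⟨?_, fun h => ⟨i, h⟩⟩
      rintro ⟨j, hj⟩
      by_cases hji : j = i
      · rwa [hji] at hj
      · rw [hzero j hji] at hj; exact absurd hj hp
    rw [Finset.sum_eq_single i, if_pos hi]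
    · simp only [hiff (fun x => 0 < x) (lt_irrefl _), hiff (fun x => x < 0) (lt_irrefl _)]
    · intro j _ hj
      simp [hzero j hj]
    · simp
  · push Not at hfacet
    rw [Finset.sum_eq_zero fun i _ => if_neg (by push Not; exact hfacet i)]
    -- Otherwise the sum of the points q has only positive coordinates and the form vanishes on it.
    -- The form therefore takes both signs on the vertices or neither, and the contributions cancel.
    have hq0 := fun a => ((mem_simplexHull ht).mp (hqt a)).1
    have hrel : ∑ i, facetForm t q (Finsupp.single (t i) 1) * ∑ a, q a (t i) = 0 := by
      simp only [Finset.mul_sum]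
      rw [Finset.sum_comm]
      simp only [← facetForm_eq_sum_single t ht, facetForm_apply_point, Finset.sum_const_zero]
    have hpos : ∀ i, 0 < ∑ a, q a (t i) := by
      intro i
      obtain ⟨a, ha⟩ := hfacet i
      exact Finset.sum_pos' (fun a _ => hq0 a i)
        ⟨a, Finset.mem_univ _, lt_of_le_of_ne (hq0 a i) (Ne.symm ha)⟩
    have hiff : (∃ i, 0 < facetForm t q (Finsupp.single (t i) 1)) ↔
        ∃ i, facetForm t q (Finsupp.single (t i) 1) < 0 := by
      constructor
      · rintro ⟨i, hi⟩
        by_contra! hc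
        have := Finset.sum_pos' (s := Finset.univ) (fun j _ => mul_nonneg (hc j) (hpos j).le)
          ⟨i, Finset.mem_univ _, mul_pos hi (hpos i)⟩
        exact this.ne' hrel
      · rintro ⟨i, hi⟩
        by_contra! hc
        have := Finset.sum_neg' (s := Finset.univ)
          (fun j _ => mul_nonpos_of_nonpos_of_nonneg (hc j) (hpos j).le)
          ⟨i, Finset.mem_univ _, mul_neg_of_neg_of_pos hi (hpos i)⟩
        exact this.ne hrel
    simp only [hiff, sub_self]

/-- A choice of an ordering of the elements of every finite set, compatible with the removal of
elements. -/
structure Ordering (E : Type*) [DecidableEq E] where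
  /-- the list of the elements of a set, if its size is as stated -/
  enum : (r : ℕ) → Finset E → Fin r → E
  injective : ∀ {r s}, s.card = r → Function.Injective (enum r s)
  image_eq : ∀ {r s}, s.card = r → Finset.univ.image (enum r s) = s
  erase : ∀ {r s}, s.card = r + 1 → ∀ j : Fin (r + 1),
    enum r (s.erase (enum (r + 1) s j)) = enum (r + 1) s ∘ j.succAbove

/-- The cochain on tuples of vertices obtained by summing a cochain over the oriented simplices of
a subdivision. -/
noncomputable def subdivisionPullback [DecidableEq (V →₀ ℝ)]
    (X : Geometry.SimplicialComplex ℝ (V →₀ ℝ))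
    (o : Ordering (V →₀ ℝ)) (r : ℕ) (φ : (Fin r → V →₀ ℝ) → ℤ) (t : Fin r → V) : ℤ :=
  ∑ σ ∈ cells X t r, isign (detAt t (o.enum r σ)) * φ (o.enum r σ)

lemma detAt_comp_perm (t : Fin r → V) (p : Fin r → V →₀ ℝ) (π : Equiv.Perm (Fin r)) :
    detAt t (p ∘ π) = (Equiv.Perm.sign π : ℤ) * detAt t p := by
  rw [detAt, detAt, ← Matrix.det_permute]
  rfl

lemma detAt_rotate (t : Fin (n + 1) → V) (p : Fin (n + 1) → V →₀ ℝ) (j : Fin (n + 1)) :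
    detAt t (Fin.cons (p j) (p ∘ j.succAbove) : Fin (n + 1) → V →₀ ℝ)
      = (-1) ^ (j : ℕ) * detAt t p := by
  have h : (Fin.cons (p j) (p ∘ j.succAbove) : Fin (n + 1) → V →₀ ℝ)
      = p ∘ (Fin.cycleRange j).symm := by
    funext i
    refine Fin.cases ?_ (fun i => ?_) i
    · simp
    · simp
  rw [h, detAt_comp_perm]
  simp

lemma mem_simplexHull_succAbove {t : Fin (n + 1) → V} (ht : Function.Injective t)
    {x : V →₀ ℝ} {i : Fin (n + 1)} :
    x ∈ simplexHull (t ∘ i.succAbove) ↔ x ∈ simplexHull t ∧ x (t i) = 0 := by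
  rw [mem_simplexHull ht, mem_simplexHull (ht.comp Fin.succAbove_right_injective)]
  rw [Fin.sum_univ_succAbove _ i]
  constructor
  · rintro ⟨h1, h2, h3⟩
    have hi : x (t i) = 0 := by
      refine h2 _ ?_
      rintro ⟨a, ha⟩
      exact Fin.succAbove_ne i a (ht ha)
    refine ⟨⟨fun j => ?_, fun v hv => h2 v ?_, ?_⟩, hi⟩
    · by_cases hj : j = i
      · rw [hj, hi]
      · obtain ⟨a, rfl⟩ := Fin.exists_succAbove_eq hj
        exact h1 a
    · rintro ⟨a, rfl⟩
      exact hv ⟨_, rfl⟩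
    · rw [hi, zero_add]; exact h3
  · rintro ⟨⟨h1, h2, h3⟩, hi⟩
    refine ⟨fun a => h1 _, fun v hv => ?_, ?_⟩
    · by_cases hvt : v ∈ Set.range t
      · obtain ⟨j, rfl⟩ := hvt
        by_cases hj : j = i
        · rw [hj, hi]
        · obtain ⟨a, rfl⟩ := Fin.exists_succAbove_eq hj
          exact absurd ⟨a, rfl⟩ hv
      · exact h2 v hvt
    · rw [hi, zero_add] at h3; exact h3

/-- The combinatorial Stokes formula: pulling back cochains to a subdivided simplex commutes with
the coboundary. -/
theorem subdivisionPullback_coboundary [Finite V] [DecidableEq (V →₀ ℝ)] (o : Ordering (V →₀ ℝ))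
    {t : Fin (n + 2) → V} (ht : Function.Injective t) (hcov : Covers X t)
    (hcov' : ∀ i : Fin (n + 2), Covers X (t ∘ i.succAbove)) (φ : (Fin (n + 1) → V →₀ ℝ) → ℤ) :
    subdivisionPullback X o (n + 2) (coboundary n φ) t
      = coboundary n (subdivisionPullback X o (n + 1) φ) t := by
  classical
  have step1 : subdivisionPullback X o (n + 2) (coboundary n φ) t
      = ∑ σ ∈ cells X t (n + 2), ∑ v ∈ σ,
        isign (facetForm t (o.enum (n + 1) (σ.erase v)) v) * φ (o.enum (n + 1) (σ.erase v)) := by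
    refine Finset.sum_congr rfl fun σ hσ => ?_
    have hc := ((mem_cells hcov).mp hσ).2.2
    conv_rhs => rw [← o.image_eq hc]
    rw [Finset.sum_image fun a _ b _ h => o.injective hc h, coboundary, Finset.mul_sum]
    refine Finset.sum_congr rfl fun j _ => ?_
    rw [o.image_eq hc, o.erase hc, ← detAt_cons, detAt_rotate, isign_mul, isign_neg_one_pow]
    ring
  -- Exchange of summation: pairs (simplex, deleted vertex) correspond to pairs (face, vertex of its
  -- link).
  have step2 : ∑ σ ∈ cells X t (n + 2), ∑ v ∈ σ,
        isign (facetForm t (o.enum (n + 1) (σ.erase v)) v) * φ (o.enum (n + 1) (σ.erase v))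
      = ∑ τ ∈ cells X t (n + 1), ∑ v ∈ link X t τ,
        isign (facetForm t (o.enum (n + 1) τ) v) * φ (o.enum (n + 1) τ) := by
    rw [Finset.sum_sigma', Finset.sum_sigma']
    refine Finset.sum_bij' (fun x _ => ⟨x.1.erase x.2, x.2⟩) (fun x _ => ⟨insert x.2 x.1, x.2⟩)
      ?_ ?_ ?_ ?_ ?_
    · rintro ⟨σ, v⟩ h
      simp only [Finset.mem_sigma] at h ⊢
      obtain ⟨hσ, hv⟩ := h
      have hσ' := (mem_cells hcov).mp hσ
      have hcard : (σ.erase v).card = n + 1 := by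
        rw [Finset.card_erase_of_mem hv, hσ'.2.2]; rfl
      refine ⟨(mem_cells hcov).mpr ⟨?_, ?_, hcard⟩, ?_⟩
      · exact X.down_closed hσ'.1 (Finset.erase_subset _ _)
          (Finset.card_pos.mp (by rw [hcard]; omega))
      · exact (Finset.coe_subset.mpr (Finset.erase_subset v σ)).trans hσ'.2.1
      · rw [mem_link, hcard, Finset.insert_erase hv]
        exact ⟨Finset.notMem_erase _ _, hσ⟩
    · rintro ⟨τ, v⟩ h
      simp only [Finset.mem_sigma] at h ⊢
      obtain ⟨hτ, hv⟩ := h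
      have hτ' := (mem_cells hcov).mp hτ
      rw [mem_link, hτ'.2.2] at hv
      exact ⟨hv.2, Finset.mem_insert_self _ _⟩
    · rintro ⟨σ, v⟩ h
      simp only [Finset.mem_sigma] at h
      simp [Finset.insert_erase h.2]
    · rintro ⟨τ, v⟩ h
      simp only [Finset.mem_sigma] at h
      simp [Finset.erase_insert (mem_link.mp h.2).1]
    · rintro ⟨σ, v⟩ h
      rfl
  rw [step1, step2]
  -- Only faces in the boundary of t survive, and their signs are those of the coboundary of the
  -- pullback.
  have step3 : ∀ τ ∈ cells X t (n + 1), ∑ v ∈ link X t τ,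
        isign (facetForm t (o.enum (n + 1) τ) v) * φ (o.enum (n + 1) τ)
      = ∑ i : Fin (n + 2), if τ ∈ cells X (t ∘ i.succAbove) (n + 1) then
          (-1) ^ (i : ℕ) * (isign (detAt (t ∘ i.succAbove) (o.enum (n + 1) τ))
            * φ (o.enum (n + 1) τ)) else 0 := by
    intro τ hτ
    have hτ' := (mem_cells hcov).mp hτ
    have himg := o.image_eq hτ'.2.2
    have hmem : ∀ a, o.enum (n + 1) τ a ∈ τ := by
      intro a
      have := Finset.mem_image_of_mem (o.enum (n + 1) τ) (Finset.mem_univ a)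
      rwa [himg] at this
    rw [← Finset.sum_mul]
    have key := sum_link_isign (q := o.enum (n + 1) τ) ht hcov (by rw [himg]; exact hτ'.1)
      fun a => hτ'.2.1 (hmem a)
    rw [himg] at key
    rw [key, Finset.sum_mul]
    refine Finset.sum_congr rfl fun i _ => ?_
    have hiff : τ ∈ cells X (t ∘ i.succAbove) (n + 1) ↔ ∀ a, o.enum (n + 1) τ a (t i) = 0 := by
      rw [mem_cells (hcov' i)]
      constructor
      · rintro ⟨-, h, -⟩ a
        exact ((mem_simplexHull_succAbove ht).mp (h (hmem a))).2
      · intro h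
        refine ⟨hτ'.1, fun x hx => ?_, hτ'.2.2⟩
        refine (mem_simplexHull_succAbove ht).mpr ⟨hτ'.2.1 hx, ?_⟩
        rw [Finset.mem_coe, ← himg] at hx
        obtain ⟨a, -, rfl⟩ := Finset.mem_image.mp hx
        exact h a
    simp only [hiff, facetForm_single ht, isign_mul, isign_neg_one_pow]
    split_ifs <;> ring
  rw [Finset.sum_congr rfl step3, Finset.sum_comm, coboundary]
  refine Finset.sum_congr rfl fun i _ => ?_
  rw [← Finset.sum_filter, subdivisionPullback, Finset.mul_sum]
  refine Finset.sum_congr ?_ fun _ _ => rfl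
  ext τ
  simp only [Finset.mem_filter, and_iff_right_iff_imp]
  intro h
  rw [mem_cells (hcov' i)] at h
  rw [mem_cells hcov]
  exact ⟨h.1, fun x hx => ((mem_simplexHull_succAbove ht).mp (h.2.1 hx)).1, h.2.2⟩

end Stokes

/-! ### Orderings of the vertices by their labels. -/

/-- Sorting by a given function, with ties broken arbitrarily. -/
lemma Ordering.exists_monotone {E β : Type*} [DecidableEq E] [Nonempty E] [LinearOrder β]
    (f : E → β) : ∃ o : Ordering E, ∀ r s, s.card = r → Monotone (f ∘ o.enum r s) := by
  classical
  -- An arbitrary injection into cardinals breaks ties. Restricting one global linear order to each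
  -- finite set makes the enumerations compatible with deletion.
  have hinj : Function.Injective fun x : E => toLex (f x, embeddingToCardinal x) := by
    intro x y h
    exact embeddingToCardinal.injective (congrArg (fun z => (ofLex z).2) h)
  let _ : LinearOrder E := LinearOrder.lift' (fun x => toLex (f x, embeddingToCardinal x)) hinj
  have hf : Monotone f := by
    intro x y hxy
    have : toLex (f x, embeddingToCardinal x) ≤ toLex (f y, embeddingToCardinal y) := hxy
    rcases Prod.Lex.le_iff.mp this with h | h
    · exact h.le
    · exact h.1.le
  let enum : (r : ℕ) → Finset E → Fin r → E := fun r s =>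
    if h : s.card = r then s.orderEmbOfFin h else fun _ => Classical.arbitrary E
  have henum : ∀ {r s} (h : s.card = r), enum r s = s.orderEmbOfFin h := fun h => dif_pos h
  refine ⟨⟨enum, fun h => ?_, fun {r s} h => ?_, fun {r s} h j => ?_⟩, fun r s h => ?_⟩
  · rw [henum h]; exact (Finset.orderEmbOfFin _ h).injective
  · rw [henum h]
    ext x
    rw [← Finset.mem_coe (s := s), ← Finset.range_orderEmbOfFin s h]
    simp only [Finset.mem_image, Finset.mem_univ, true_and, Set.mem_range]
  · have hmem : enum (r + 1) s j ∈ s := by rw [henum h]; exact Finset.orderEmbOfFin_mem s h j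
    have hc : (s.erase (enum (r + 1) s j)).card = r := by
      rw [Finset.card_erase_of_mem hmem, h]; rfl
    rw [henum hc]
    refine (Finset.orderEmbOfFin_unique _ (fun i => ?_) ?_).symm
    · rw [Finset.mem_erase, henum h]
      exact ⟨fun h' => Fin.succAbove_ne j i ((Finset.orderEmbOfFin s h).injective h'),
        Finset.orderEmbOfFin_mem s h _⟩
    · rw [henum h]
      exact (Finset.orderEmbOfFin s h).strictMono.comp (Fin.strictMono_succAbove j)
  · change Monotone (f ∘ enum r s)
    rw [henum h]
    exact hf.comp (Finset.orderEmbOfFin s h).monotone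

lemma eq_of_image_eq_of_strictMono {E β : Type*} [DecidableEq E] [LinearOrder β] {f : E → β}
    {r : ℕ} {p q : Fin r → E} (h : Finset.univ.image p = Finset.univ.image q)
    (hp : StrictMono (f ∘ p)) (hq : StrictMono (f ∘ q)) : p = q := by
  have hrange : Set.range p = Set.range q := by
    simpa using congrArg (fun s : Finset E => (s : Set E)) h
  have hfpq : f ∘ p = f ∘ q := by
    refine (StrictMono.range_inj hp hq).mp ?_
    rw [Set.range_comp, Set.range_comp, hrange]
  funext i
  obtain ⟨j, hj⟩ : p i ∈ Set.range q := hrange ▸ ⟨i, rfl⟩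
  have h1 : (f ∘ q) j = (f ∘ q) i := by
    rw [← congrFun hfpq i]
    simp [hj]
  rw [← hj, hq.injective h1]

/-! ### Vanishing of the bar cochains on simplices of the target. -/

section Target

variable {k m d n : ℕ} [NeZero k]

/-- A simplex of the target has at most one vertex in each copy. A repeated first coordinate thus
forces two equal neighbouring vertices, where the normalized cochain vanishes. -/
lemma barCochain_eq_zero_of_not_strictMono {q : Fin (n + 1) → Fin m × ZMod k}
    (hq : Finset.univ.image q ∈ (zkJoinAlt k m d).faces) (hmono : Monotone fun i => (q i).1)
    (h : ¬ StrictMono fun i => (q i).1) : barCochain n (fun i => (q i).2) = 0 := by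
  obtain ⟨-, i, -, hi⟩ := hq
  have hqi : ∀ a, (q a).2 = i (q a).1 := by
    intro a
    obtain ⟨b, -, hb⟩ := Finset.mem_image.mp (hi (Finset.mem_image_of_mem q (Finset.mem_univ a)))
    rw [← hb]
  rw [Fin.strictMono_iff_lt_succ] at h
  push Not at h
  obtain ⟨j, hj⟩ := h
  have he : (q j.castSucc).1 = (q j.succ).1 := (hmono j.castSucc_lt_succ.le).antisymm hj
  refine barCochain_eq_zero n _ j (by omega) ?_
  change (q j.castSucc).2 = (q j.succ).2
  rw [hqi, hqi, he]

lemma exists_jump_between {α : Type*} (I : ℕ → α) {a b : ℕ} (hab : a ≤ b) (h : I a ≠ I b) :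
    ∃ u, a ≤ u ∧ u < b ∧ I u ≠ I (u + 1) := by
  by_contra! hc
  refine h ?_
  induction b, hab using Nat.le_induction with
  | base => rfl
  | succ b hb ih =>
    rw [← hc b hb (Nat.lt_succ_self b)]
    by_contra hne
    exact hne (ih hne fun u h1 h2 => hc u h1 (h2.trans (Nat.lt_succ_self b)))

/-- A nonzero value requires all n neighbouring pairs of signs to differ. Each pair yields a jump of
the ambient tuple, in disjoint ranges of positions, so there would be n > d jumps. -/
lemma barCochain_eq_zero_of_jumps {q : Fin (n + 1) → Fin m × ZMod k}
    (hq : Finset.univ.image q ∈ (zkJoinAlt k m d).faces) (hmono : Monotone fun i => (q i).1)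
    (hn : d < n) : barCochain n (fun i => (q i).2) = 0 := by
  by_contra hne
  have hstrict : StrictMono fun i => (q i).1 := by
    by_contra h
    exact hne (barCochain_eq_zero_of_not_strictMono hq hmono h)
  have hadj : ∀ j : Fin n, (q j.castSucc).2 ≠ (q j.succ).2 :=
    fun j hj => hne (barCochain_eq_zero n _ j (by omega) hj)
  obtain ⟨-, i, hjumps, hi⟩ := hq
  have hqi : ∀ a, (q a).2 = i (q a).1 := by
    intro a
    obtain ⟨b, -, hb⟩ := Finset.mem_image.mp (hi (Finset.mem_image_of_mem q (Finset.mem_univ a)))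
    rw [← hb]
  -- The default value is never compared: the jumps found below satisfy u + 1 < m.
  let I : ℕ → ZMod k := fun u => if h : u < m then i ⟨u, h⟩ else 0
  have hI : ∀ u (h : u < m), I u = i ⟨u, h⟩ := fun u h => dif_pos h
  have hex : ∀ j : Fin n, ∃ u : ℕ, ((q j.castSucc).1 : ℕ) ≤ u ∧ u < (q j.succ).1 ∧
      I u ≠ I (u + 1) := by
    intro j
    refine exists_jump_between I (hmono j.castSucc_lt_succ.le) ?_
    rw [hI _ (q j.castSucc).1.2, hI _ (q j.succ).1.2]
    have := hadj j
    rwa [hqi, hqi] at this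
  choose u hu1 hu2 hu3 using hex
  have hum : ∀ j, u j < m - 1 := by
    intro j
    have := hu2 j
    have := (q j.succ).1.2
    omega
  have humono : StrictMono u := by
    intro a b hab
    refine (hu2 a).trans_le (le_trans ?_ (hu1 b))
    exact hmono (show a.succ ≤ b.castSucc from Fin.succ_le_castSucc_iff.mpr hab)
  have hcard : (Finset.univ : Finset (Fin n)).card ≤ jumps i := by
    refine Finset.card_le_card_of_injOn (fun j => ⟨u j, hum j⟩) ?_ ?_
    · intro j _
      have h1 := hum j
      have := hu3 j
      rw [hI _ (by omega), hI _ (by omega)] at this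
      simpa using this
    · intro a _ b _ hab
      exact humono.injective (congrArg Fin.val hab)
  rw [Finset.card_univ, Fintype.card_fin] at hcard
  omega

end Target

/-! ### Equivariance and the coboundary relation of the label cochains. -/

section Main

variable {k d m : ℕ}

lemma shift_injective {m : ℕ} (g : ZMod k) : Function.Injective (shift (m := m) g) := by
  intro p q h
  have := congrArg (shift (-g)) h
  simpa [shift_shift, shift_zero] using this

lemma act_apply_shift {m : ℕ} (g : ZMod k) (x : Fin m × ZMod k →₀ ℝ) (v : Fin m × ZMod k) :
    act g x (shift g v) = x v :=
  Finsupp.mapDomain_apply (shift_injective g) x v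

lemma act_act {m : ℕ} (g h : ZMod k) (x : Fin m × ZMod k →₀ ℝ) :
    act g (act h x) = act (g + h) x := by
  simp only [act, Finsupp.lmapDomain_apply, ← Finsupp.mapDomain_comp]
  congr 1
  funext v
  exact shift_shift g h v

lemma act_zero {m : ℕ} (x : Fin m × ZMod k →₀ ℝ) : act 0 x = x := by
  have : (shift (0 : ZMod k) : Fin m × ZMod k → _) = id := by funext v; exact shift_zero v
  simp only [act, Finsupp.lmapDomain_apply, this, Finsupp.mapDomain_id]

lemma act_injective {m : ℕ} (g : ZMod k) :
    Function.Injective (act g : (Fin m × ZMod k →₀ ℝ) →ₗ[ℝ] _) :=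
  Finsupp.mapDomain_injective (shift_injective g)

lemma detAt_act {m r : ℕ} (g : ZMod k) (t : Fin r → Fin m × ZMod k)
    (p : Fin r → Fin m × ZMod k →₀ ℝ) : detAt (shift g ∘ t) (act g ∘ p) = detAt t p := by
  unfold detAt
  congr 1
  ext i j
  exact act_apply_shift g _ _

lemma simplexHull_shift {m r : ℕ} (g : ZMod k) (t : Fin r → Fin m × ZMod k) :
    simplexHull (shift g ∘ t) = act g '' simplexHull t := by
  rw [simplexHull, simplexHull, LinearMap.image_convexHull, ← Set.range_comp]
  congr 1
  refine congrArg Set.range ?_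
  funext i
  simp [act, Finsupp.mapDomain_single]

lemma covers_of_isSubdivision {r : ℕ} {X : Geometry.SimplicialComplex ℝ (Fin m × ZMod k →₀ ℝ)}
    (hX : IsSubdivision X (Geometry.SimplicialComplex.onFinsupp (zkJoin k m)))
    {t : Fin (r + 1) → Fin m × ZMod k} (ht : Function.Injective fun i => (t i).1) :
    Covers X t := by
  have hface : Finset.univ.image t ∈ (zkJoin k m).faces := by
    refine ⟨Finset.univ_nonempty.image t, fun j => ?_⟩
    by_cases hj : ∃ a, (t a).1 = j
    · obtain ⟨a, rfl⟩ := hj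
      refine Or.inr ⟨(t a).2, ?_⟩
      ext v
      simp only [slice, Finset.mem_image, Finset.mem_filter, Finset.mem_univ, true_and,
        Finset.mem_singleton]
      constructor
      · rintro ⟨_, ⟨⟨b, rfl⟩, hb⟩, rfl⟩
        rw [ht hb]
      · rintro rfl
        exact ⟨_, ⟨⟨a, rfl⟩, rfl⟩, rfl⟩
    · refine Or.inl ?_
      rw [slice, Finset.image_eq_empty, Finset.filter_eq_empty_iff]
      rintro p hp rfl
      obtain ⟨a, -, rfl⟩ := Finset.mem_image.mp hp
      exact hj ⟨a, rfl⟩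
  obtain ⟨F, hF, hFX, hcov⟩ := hX.2 ((Finset.univ.image t).image fun i => Finsupp.single i (1 : ℝ))
    ⟨_, hface, rfl⟩
  refine ⟨F, hF, hFX, hcov ▸ ?_⟩
  rw [simplexHull, Finset.image_image]
  simp [Function.comp_def]

lemma cells_shift {r s : ℕ} {X : Geometry.SimplicialComplex ℝ (Fin m × ZMod k →₀ ℝ)}
    (hX : ∀ g : ZMod k, ∀ s ∈ X.faces, s.image (act g) ∈ X.faces) {t : Fin r → Fin m × ZMod k}
    (hcov : ∀ g, Covers X (shift g ∘ t)) (g : ZMod k) :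
    cells X (shift g ∘ t) s = (cells X t s).image (Finset.image (act g)) := by
  have hcov0 : Covers X t := by
    have := hcov 0
    rwa [show shift 0 ∘ t = t from funext fun i => shift_zero _] at this
  ext σ
  rw [Finset.mem_image, mem_cells (hcov g)]
  constructor
  · rintro ⟨h1, h2, h3⟩
    have hback : (σ.image (act (-g))).image (act g) = σ := by
      rw [Finset.image_image]
      have : (act g ∘ act (-g) : (Fin m × ZMod k →₀ ℝ) → _) = id := by
        funext x; simp [act_act, act_zero]
      rw [this, Finset.image_id]
    refine ⟨σ.image (act (-g)), (mem_cells hcov0).mpr ⟨hX _ _ h1, ?_, ?_⟩, hback⟩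
    · intro x hx
      obtain ⟨y, hy, rfl⟩ := Finset.mem_image.mp (Finset.mem_coe.mp hx)
      have := h2 hy
      rw [simplexHull_shift] at this
      obtain ⟨z, hz, rfl⟩ := this
      rwa [act_act, neg_add_cancel, act_zero]
    · rw [Finset.card_image_of_injective _ (act_injective _), h3]
  · rintro ⟨τ, hτ, rfl⟩
    rw [mem_cells hcov0] at hτ
    refine ⟨hX _ _ hτ.1, ?_, ?_⟩
    · rw [simplexHull_shift, Finset.coe_image]
      exact Set.image_mono hτ.2.1
    · rw [Finset.card_image_of_injective _ (act_injective _), hτ.2.2]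

lemma Ordering.image_comp {E W : Type*} [DecidableEq E] [DecidableEq W] (o : Ordering E) {r : ℕ}
    {s : Finset E} (h : s.card = r) (f : E → W) :
    Finset.univ.image (fun i => f (o.enum r s i)) = s.image f := by
  conv_rhs => rw [← o.image_eq h, Finset.image_image]
  rfl

lemma Ordering.enum_mem {E : Type*} [DecidableEq E] (o : Ordering E) {r : ℕ}
    {s : Finset E} (h : s.card = r) (i : Fin r) : o.enum r s i ∈ s := by
  have := Finset.mem_image_of_mem (o.enum r s) (Finset.mem_univ i)
  rwa [o.image_eq h] at this

/-- The pullback of the bar cochains along a labelling of the vertices of a subdivision. -/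
noncomputable def labelCochain {N : ℕ} (X : Geometry.SimplicialComplex ℝ (Fin N × ZMod k →₀ ℝ))
    (o : Ordering (Fin N × ZMod k →₀ ℝ)) (ℓ : (Fin N × ZMod k →₀ ℝ) → Fin m × ZMod k) (n : ℕ)
    (t : Fin (n + 1) → Fin N × ZMod k) : ℤ :=
  subdivisionPullback X o (n + 1) (fun p => barCochain n fun i => (ℓ (p i)).2) t

variable {N : ℕ} {X : Geometry.SimplicialComplex ℝ (Fin N × ZMod k →₀ ℝ)}
  {o : Ordering (Fin N × ZMod k →₀ ℝ)} {ℓ : (Fin N × ZMod k →₀ ℝ) → Fin m × ZMod k}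

lemma mem_vertices_of_mem {s : Finset (Fin N × ZMod k →₀ ℝ)} (hs : s ∈ X.faces)
    {v : Fin N × ZMod k →₀ ℝ} (hv : v ∈ s) : v ∈ X.vertices :=
  X.down_closed hs (Finset.singleton_subset_iff.mpr hv) (Finset.singleton_nonempty v)

/-- A face covering a single point can only be that point, so vertices of the join are vertices of
X. -/
lemma cells_vertex {v : Fin N × ZMod k} (hcov : Covers X fun _ : Fin 1 => v) :
    cells X (fun _ : Fin 1 => v) 1 = {{Finsupp.single v 1}} := by
  have hhull : simplexHull (fun _ : Fin 1 => v) = {Finsupp.single v 1} := by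
    rw [simplexHull, Set.range_const, convexHull_singleton]
  ext σ
  rw [mem_cells hcov, Finset.mem_singleton, hhull]
  constructor
  · rintro ⟨-, h1, h2⟩
    obtain ⟨x, rfl⟩ := Finset.card_eq_one.mp h2
    simpa using h1
  · rintro rfl
    refine ⟨?_, by simp, by simp⟩
    obtain ⟨F, -, hFX, h⟩ := hcov
    have hmem : (Finsupp.single v 1 : Fin N × ZMod k →₀ ℝ) ∈
        ⋃ s ∈ F, convexHull ℝ (s : Set (Fin N × ZMod k →₀ ℝ)) := by
      rw [← h, hhull]; rfl
    simp only [Set.mem_iUnion] at hmem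
    obtain ⟨s, hs, -⟩ := hmem
    have hsub : (s : Set (Fin N × ZMod k →₀ ℝ)) ⊆ {Finsupp.single v 1} := by
      rw [← hhull, h]
      exact (subset_convexHull ℝ _).trans (Set.subset_biUnion_of_mem (u := fun s : Finset _ =>
        convexHull ℝ (s : Set (Fin N × ZMod k →₀ ℝ))) hs)
    have hse : s = {Finsupp.single v 1} := by
      rw [← Finset.coe_singleton, Finset.coe_subset] at hsub
      exact (Finset.subset_singleton_iff.mp hsub).resolve_left
        (X.nonempty_of_mem_faces (hFX hs)).ne_empty
    exact hse ▸ hFX hs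

variable [NeZero k]

/-- The vertex ordering need not be equivariant, since ties are broken arbitrarily. This is
harmless: without ties, g carries the ordering of σ to that of gσ because the action fixes the first
coordinates of labels; with ties, both cochains vanish. -/
lemma labelCochain_shift (hX : ∀ g : ZMod k, ∀ s ∈ X.faces, s.image (act g) ∈ X.faces)
    (ho : ∀ r s, s.card = r → Monotone ((fun x => (ℓ x).1) ∘ o.enum r s))
    (hℓ : IsSimplicialMap X.toPreAbstractSimplicialComplex (zkJoinAlt k m d) ℓ)
    (hequiv : ∀ g : ZMod k, ∀ v ∈ X.vertices, ℓ (act g v) = shift g (ℓ v))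
    {n : ℕ} {t : Fin (n + 1) → Fin N × ZMod k} (hcov : ∀ g, Covers X (shift g ∘ t)) (g : ZMod k) :
    labelCochain X o ℓ n (shift g ∘ t) = subdivisionPullback X o (n + 1)
      (fun p => barCochain n fun i => g + (ℓ (p i)).2) t := by
  have hcov0 : Covers X t := by
    have := hcov 0
    rwa [show shift 0 ∘ t = t from funext fun i => shift_zero _] at this
  rw [labelCochain, subdivisionPullback, cells_shift hX hcov,
    Finset.sum_image fun a _ b _ h => Finset.image_injective (act_injective g) h]
  refine Finset.sum_congr rfl fun σ hσ => ?_
  obtain ⟨hσX, -, hσc⟩ := (mem_cells hcov0).mp hσ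
  have hgc : (σ.image (act g)).card = n + 1 := by
    rw [Finset.card_image_of_injective _ (act_injective g), hσc]
  have hℓg : ∀ i, ℓ (act g (o.enum (n + 1) σ i)) = shift g (ℓ (o.enum (n + 1) σ i)) := fun i =>
    hequiv g _ (mem_vertices_of_mem hσX (o.enum_mem hσc i))
  set p := o.enum (n + 1) σ with hp
  set p' := o.enum (n + 1) (σ.image (act g)) with hp'
  have himg : Finset.univ.image p' = Finset.univ.image (act g ∘ p) := by
    rw [hp', o.image_eq hgc, hp]
    exact (o.image_comp hσc (act g)).symm
  have hface' : Finset.univ.image (fun i => ℓ (p' i)) ∈ (zkJoinAlt k m d).faces := by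
    rw [hp', o.image_comp hgc]
    exact hℓ _ (hX g σ hσX)
  have hfaceg : Finset.univ.image (fun i => ℓ (act g (p i))) ∈ (zkJoinAlt k m d).faces := by
    have := o.image_comp hσc fun x => ℓ (act g x)
    rw [hp, this, show (fun x => ℓ (act g x)) = ℓ ∘ act g from rfl, ← Finset.image_image]
    exact hℓ _ (hX g σ hσX)
  have hfst : (fun i => (ℓ (act g (p i))).1) = fun i => (ℓ (p i)).1 := by
    funext i; rw [hℓg]; rfl
  have hsnd : (fun i => (ℓ (act g (p i))).2) = fun i => g + (ℓ (p i)).2 := by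
    funext i; rw [hℓg]; rfl
  have hmono : Monotone fun i => (ℓ (p i)).1 := ho _ _ hσc
  have hmono' : Monotone fun i => (ℓ (p' i)).1 := ho _ _ hgc
  by_cases hs : StrictMono fun i => (ℓ (p' i)).1
  · by_cases hs' : StrictMono fun i => (ℓ (p i)).1
    · have hpp : p' = act g ∘ p := by
        refine eq_of_image_eq_of_strictMono (f := fun x => (ℓ x).1) himg hs ?_
        change StrictMono fun i => (ℓ (act g (p i))).1
        rwa [hfst]
      beta_reduce
      rw [hpp, detAt_act, ← hsnd]
      rfl
    · exfalso
      refine hs' (hmono.strictMono_of_injective fun a b hab => ?_)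
      have hinj : Set.InjOn (fun x => (ℓ x).1) (Set.range p') := by
        rintro _ ⟨a, rfl⟩ _ ⟨b, rfl⟩ h
        rw [hs.injective h]
      have hr : Set.range p' = Set.range (act g ∘ p) := by
        have := congrArg (fun s : Finset _ => (s : Set (Fin N × ZMod k →₀ ℝ))) himg
        simpa only [Finset.coe_image, Finset.coe_univ, Set.image_univ] using this
      have h1 : (act g ∘ p) a = (act g ∘ p) b := by
        refine hinj (hr ▸ ⟨a, rfl⟩) (hr ▸ ⟨b, rfl⟩) ?_
        have := hab
        rw [← hfst] at this
        exact this
      exact o.injective hσc (act_injective g h1)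
  · rw [barCochain_eq_zero_of_not_strictMono hface' hmono' hs]
    suffices h : ¬ StrictMono fun i => (ℓ (act g (p i))).1 by
      beta_reduce
      rw [← hsnd, barCochain_eq_zero_of_not_strictMono hfaceg (by rw [hfst]; exact hmono) h,
        mul_zero, mul_zero]
    rw [hfst]
    intro hs'
    refine hs (hmono'.strictMono_of_injective fun a b hab => ?_)
    have hr : ∀ a, ∃ c, act g (p c) = p' a := by
      intro a
      have := Finset.mem_image_of_mem p' (Finset.mem_univ a)
      rw [himg] at this
      obtain ⟨c, -, hc⟩ := Finset.mem_image.mp this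
      exact ⟨c, hc⟩
    obtain ⟨a', ha⟩ := hr a
    obtain ⟨b', hb⟩ := hr b
    have h1 : (fun i => (ℓ (act g (p i))).1) a' = (fun i => (ℓ (act g (p i))).1) b' := by
      simp only [ha, hb]
      exact hab
    rw [hfst] at h1
    refine o.injective hgc (show p' a = p' b from ?_)
    rw [← ha, ← hb, hs'.injective h1]

lemma coboundary_labelCochain (hX : IsEquivariantSubdivision X)
    (ho : ∀ r s, s.card = r → Monotone ((fun x => (ℓ x).1) ∘ o.enum r s))
    (hℓ : IsSimplicialMap X.toPreAbstractSimplicialComplex (zkJoinAlt k m d) ℓ)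
    (hequiv : ∀ g : ZMod k, ∀ v ∈ X.vertices, ℓ (act g v) = shift g (ℓ v))
    {n : ℕ} {t : Fin (n + 2) → Fin N × ZMod k} (ht : Function.Injective fun i => (t i).1) :
    coboundary n (labelCochain X o ℓ n) t
      = resolutionOp shift n (n + 2) (labelCochain X o ℓ (n + 1)) t := by
  have hcov : ∀ g, Covers X (shift g ∘ t) := fun g => covers_of_isSubdivision hX.1 ht
  have hcov0 : Covers X t := covers_of_isSubdivision hX.1 ht
  have hinj : Function.Injective t := fun a b h => ht (congrArg Prod.fst h)
  have h1 := subdivisionPullback_coboundary o hinj hcov0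
    (fun i => covers_of_isSubdivision hX.1 (ht.comp Fin.succAbove_right_injective))
    (fun p => barCochain n fun i => (ℓ (p i)).2)
  refine h1.symm.trans ?_
  have h2 : coboundary n (fun p : Fin (n + 1) → Fin N × ZMod k →₀ ℝ =>
        barCochain n fun i => (ℓ (p i)).2)
      = fun p => resolutionOp (fun g x => g + x) n (n + 2) (barCochain (n + 1))
          fun i => (ℓ (p i)).2 := by
    funext p
    exact coboundary_barCochain n fun i => (ℓ (p i)).2
  rw [h2]
  simp only [resolutionOp, labelCochain_shift hX.2 ho hℓ hequiv hcov]
  split_ifs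
  · simp only [subdivisionPullback, labelCochain, mul_sub, Finset.sum_sub_distrib]
    rfl
  · simp only [subdivisionPullback, Finset.mul_sum]
    rw [Finset.sum_comm]
    rfl

/-- In the orbit of a vertex exactly one translate has sign 0. This normalizes the augmentation in
degree 0. -/
lemma sum_labelCochain_vertex (hX : IsEquivariantSubdivision X)
    (ho : ∀ r s, s.card = r → Monotone ((fun x => (ℓ x).1) ∘ o.enum r s))
    (hℓ : IsSimplicialMap X.toPreAbstractSimplicialComplex (zkJoinAlt k m d) ℓ)
    (hequiv : ∀ g : ZMod k, ∀ v ∈ X.vertices, ℓ (act g v) = shift g (ℓ v))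
    (v : Fin N × ZMod k) :
    ∑ g : ZMod k, labelCochain X o ℓ 0 (shift g ∘ fun _ => v) = 1 := by
  have hinj : Function.Injective fun i : Fin 1 => ((fun _ : Fin 1 => v) i).1 :=
    Function.injective_of_subsingleton _
  have hcov : ∀ g, Covers X (shift g ∘ fun _ : Fin 1 => v) :=
    fun g => covers_of_isSubdivision hX.1 hinj
  simp only [labelCochain_shift hX.2 ho hℓ hequiv hcov, subdivisionPullback]
  rw [cells_vertex (covers_of_isSubdivision hX.1 hinj)]
  have henum : o.enum 1 {Finsupp.single v 1} 0 = Finsupp.single v 1 :=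
    Finset.mem_singleton.mp (o.enum_mem (by simp) 0)
  have hdet : detAt (fun _ : Fin 1 => v) (o.enum 1 {Finsupp.single v 1}) = 1 := by
    rw [detAt, Matrix.det_fin_one, Matrix.of_apply, henum]
    simp
  simp only [Finset.sum_singleton]
  rw [hdet, ← Finset.mul_sum]
  simp only [barCochain]
  rw [sum_add_eq_zero]
  simp [isign]

end Main

end ZkTucker

/-! ### The contradiction between degrees 0 and d + 1. -/

theorem corollary5p8 (k : ℕ) (hk : 2 ≤ k) (d m : ℕ) (hm : d + 1 ≤ m)
    (X : Geometry.SimplicialComplex ℝ (Fin (d + 2) × ZMod k →₀ ℝ))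
    (hX : ZkTucker.IsEquivariantSubdivision X) :
    ¬ ∃ ℓ : (Fin (d + 2) × ZMod k →₀ ℝ) → Fin m × ZMod k,
      ZkTucker.IsSimplicialMap X.toPreAbstractSimplicialComplex (ZkTucker.zkJoinAlt k m d) ℓ ∧
      ∀ g : ZMod k, ∀ v ∈ X.vertices, ℓ (ZkTucker.act g v) = ZkTucker.shift g (ℓ v) := by
  rintro ⟨ℓ, hℓ, hequiv⟩
  have : NeZero k := ⟨by omega⟩
  obtain ⟨o, ho⟩ := ZkTucker.Ordering.exists_monotone fun x => (ℓ x).1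
  -- The augmentation, equal to 1 in degree 0, is carried up to the top dimension d + 1 of the join.
  have hstep : ∀ n ≤ d + 1, (1 : ℤ) ≡ ∑ g : ZMod k, ZkTucker.conePairing n
      (fun t => ZkTucker.labelCochain X o ℓ n (ZkTucker.shift g ∘ t)) [ZMOD k] := by
    intro n
    induction n with
    | zero =>
      intro _
      have := ZkTucker.sum_labelCochain_vertex hX ho hℓ hequiv (0, 0)
      rw [← this]
      rfl
    | succ n ih =>
      intro hn
      exact (ih (by omega)).trans (ZkTucker.conePairing_norm_modEq (by omega) _ _ fun t ht =>
        ZkTucker.coboundary_labelCochain hX ho hℓ hequiv ht.2)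
  have htop : ∀ t : Fin (d + 2) → Fin (d + 2) × ZMod k, ZkTucker.IsConeTuple (d + 1) t →
      ZkTucker.labelCochain X o ℓ (d + 1) t = 0 := by
    intro t ht
    refine Finset.sum_eq_zero fun σ hσ => ?_
    obtain ⟨hσX, -, hσc⟩ :=
      (ZkTucker.mem_cells (ZkTucker.covers_of_isSubdivision hX.1 ht.2)).mp hσ
    beta_reduce
    rw [ZkTucker.barCochain_eq_zero_of_jumps (d := d) (q := fun i => ℓ (o.enum _ σ i))
      (by rw [o.image_comp hσc]; exact hℓ σ hσX) (ho _ _ hσc) (Nat.lt_succ_self d), mul_zero]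
  have h := hstep (d + 1) le_rfl
  rw [Finset.sum_eq_zero fun g _ => ?_] at h
  · have h1 := (Int.modEq_zero_iff_dvd.mp h)
    have := Int.le_of_dvd one_pos h1
    omega
  · rw [ZkTucker.conePairing_congr le_rfl fun t ht => htop _ (ht.shift g)]
    exact (ZkTucker.conePairingHom (d + 1)).map_zero
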